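/- A triangulation is a maximal planar graph, i.e. a planar graph to which no edge can be added without destroying planarity. Write $\gamma(G)$ for the smallest number of vertices in a dominating set of a graph $G$, and $\gamma_c(G)$ for the smallest number of vertices in a dominating set of $G$ that induces a connected subgraph. **Proposition.** There exists a family of triangulations of the plane $\{H_k\}_{k\ge 1}$ for which $\gamma_c(H_k)-\gamma(H_k)$ grows arbitrarily large, i.e. $\gamma_c(H_k)-\gamma(H_k)\to\infty$ as $k\to\infty$. Such a family can be obtained as follows. For $k\ge 1$ take $k$ copies $G_1,\dots,G_k$ of the icosahedron graph, the outer face of $G_i$ being a triangle with vertices $u$, $p_{i-1}$, $p_i$, where the vertex $u$ is common to all the copies, consecutive copies $G_i$ and $G_{i+1}$ are glued along the edge $up_i$, and the copies have no other vertices or edges in common; the outer face of the resulting plane graph is bounded by the cycle $u\,p_0\,p_1\cdots p_k$. Let $H_k$ be a triangulation obtained from this graph by adding edges between vertices of that cycle. Such triangulations $H_k$ exist for every $k\ge 1$, and every one of them has $$\gamma(H_k)=k+1,\qquad \gamma_c(H_k)=2k+\lceil k/2\rceil+1 .$$ Hence $\gamma_c(H_k)-\gamma(H_k)=k+\lceil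 k/2\rceil$, which is unbounded. -/

import Mathlib

open Filter

namespace SimpleGraph

section Domination

variable {V : Type*} (G : SimpleGraph V)

/-- Every vertex of `G` lies in `S` or is adjacent to a vertex of `S`. -/
def IsDominatingSet (S : Finset V) : Prop :=
  ∀ v, v ∈ S ∨ ∃ w ∈ S, G.Adj v w

/-- A dominating set inducing a connected (in particular nonempty) subgraph. -/
def IsConnectedDominatingSet (S : Finset V) : Prop :=
  G.IsDominatingSet S ∧ (G.induce (S : Set V)).Connected

/-- The domination number `γ(G)`. -/
noncomputable def dominationNumber : ℕ :=
  sInf {n | ∃ S : Finset V, G.IsDominatingSet S ∧ S.card = n}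

/-- The connected domination number `γ_c(G)` (with the junk value `0` if there is no connected
dominating set). -/
noncomputable def connectedDominationNumber : ℕ :=
  sInf {n | ∃ S : Finset V, G.IsConnectedDominatingSet S ∧ S.card = n}

end Domination

section Planarity

variable {V : Type*} (G : SimpleGraph V)

/-- A rotation system (combinatorial embedding in a closed oriented surface): a permutation of the
darts (oriented edges) of `G` whose cycles are exactly the sets of darts with a common tail, that
is, a cyclic order of the edges around every vertex. -/
structure RotationSystem where
  next : Equiv.Perm G.Dart
  fst_next : ∀ d, (next d).fst = d.fst
  sameCycle : ∀ d e : G.Dart, d.fst = e.fst → next.SameCycle d e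

variable {G}

/-- The permutation taking a dart to the following dart on the boundary walk of its face:
traverse the edge, then turn to the next edge around the vertex that is reached. -/
def RotationSystem.facePerm (R : G.RotationSystem) : Equiv.Perm G.Dart :=
  (Dart.symm_involutive (G := G)).toPerm.trans R.next

/-- The faces of a combinatorial embedding: the cycles of the face permutation. (An isolated vertex
bears no dart, so the single face of its component is not among them.) -/
def RotationSystem.Face (R : G.RotationSystem) : Type _ :=
  Quotient (Equiv.Perm.SameCycle.setoid R.facePerm)

variable (G)

/-- A finite graph is planar if it can be drawn on the sphere (equivalently, in the plane)
without crossings, that is, if it has a combinatorial embedding all of whose connected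
components have genus `0`. Since `V - E + F = 2 - 2g ≤ 2` holds for each component, with its own
faces counted, this says that `V - E + F` summed over the components is `2 C`; the faces
of the components which are isolated vertices are counted separately. -/
def IsPlanar [Finite V] : Prop :=
  ∃ R : G.RotationSystem,
    Nat.card V + (Nat.card R.Face + Nat.card {v : V // ∀ w, ¬ G.Adj v w}) =
      Nat.card G.edgeSet + 2 * Nat.card G.ConnectedComponent

/-- A triangulation is a maximal planar graph: it is planar, and adding any edge
destroys planarity. -/
def IsTriangulation [Finite V] : Prop :=
  G.IsPlanar ∧ ∀ x y : V, x ≠ y → ¬ G.Adj x y → ¬ (G ⊔ edge x y).IsPlanar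

end Planarity

end SimpleGraph

/-- The edges of the icosahedron: the outer triangle `0 1 2`, the hexagon `3 4 5 6 7 8`, the inner
triangle `9 10 11`, and the edges from the two triangles to the hexagon. -/
def icosahedronEdges : List (Fin 12 × Fin 12) :=
  [(0, 1), (0, 2), (1, 2),
   (3, 4), (4, 5), (5, 6), (6, 7), (7, 8), (8, 3),
   (9, 10), (9, 11), (10, 11),
   (0, 7), (0, 8), (0, 3), (1, 3), (1, 4), (1, 5), (2, 5), (2, 6), (2, 7),
   (9, 8), (9, 3), (9, 4), (10, 4), (10, 5), (10, 6), (11, 6), (11, 7), (11, 8)]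

/-- The icosahedron graph, with the face `0 1 2` as its outer face. -/
def icosahedron : SimpleGraph (Fin 12) :=
  SimpleGraph.fromRel fun a b => (a, b) ∈ icosahedronEdges

/-- The vertices of `k` icosahedra glued along edges in a chain around a common vertex:
the common vertex `u`; the other vertices `p₀, …, p_k` of the outer triangles; and the nine
remaining vertices of each of the `k` copies. -/
abbrev GluedVertex (k : ℕ) : Type :=
  Unit ⊕ Fin (k + 1) ⊕ (Fin k × Fin 9)

/-- The common vertex `u`. -/
def hub (k : ℕ) : GluedVertex k := Sum.inl ()

/-- The vertex `p_j`. -/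
def rim {k : ℕ} (j : Fin (k + 1)) : GluedVertex k := Sum.inr (Sum.inl j)

/-- The position of the `i`-th icosahedron: its outer triangle `0 1 2` becomes `u p_i p_{i+1}`,
and its other vertices are its own. Thus consecutive copies `i`, `i + 1` are glued along the
edge `u p_{i+1}`. -/
def copyVertex {k : ℕ} (i : Fin k) (a : Fin 12) : GluedVertex k :=
  if a = 0 then hub k
  else if a = 1 then rim i.castSucc
  else if a = 2 then rim i.succ
  else Sum.inr (Sum.inr (i, Fin.ofNat 9 (a.val - 3)))

/-- The graph obtained from `k` icosahedra by the gluing. Its outer face is bounded by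
the cycle `u p₀ p₁ … p_k`. -/
def gluedIcosahedra (k : ℕ) : SimpleGraph (GluedVertex k) :=
  ⨆ i : Fin k, icosahedron.map (copyVertex i)

/-- The vertices on the boundary of the outer face: `u, p₀, …, p_k`. -/
def outerVertices (k : ℕ) : Set (GluedVertex k) :=
  {x | x = hub k ∨ ∃ j, x = rim j}

/-- `H` is a completion of the glued icosahedra: a triangulation on the same vertices that arises
by adding edges between vertices on the boundary of the outer face. -/
def IsCompletion (k : ℕ) (H : SimpleGraph (GluedVertex k)) : Prop :=
  H.IsTriangulation ∧ gluedIcosahedra k ≤ H ∧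
    ∀ x y, H.Adj x y → ¬ (gluedIcosahedra k).Adj x y →
      x ∈ outerVertices k ∧ y ∈ outerVertices k

/-!
The domination numbers only depend on the following: in a completion, the nine inner vertices of
each icosahedron have no neighbours outside of it. So the inner vertices of each copy are
dominated from within the copy, and a connected set can enter the inside of a copy only across its
outer triangle.

For `γ`, each copy contains an inner vertex of any dominating set `S`, and two of them if `S`
misses the outer cycle altogether; hence `|S| ≥ k + 1` (`IsCompletion.succ_le_card`). The vertex
`u` and its antipodes attain this.

For `γ_c`, let `S` be connected, dominating and not disjoint from the outer cycle. Each copy has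
at least two inner vertices in `S` (`IsCompletion.two_le_card_innerTrace`), and exactly two only
if two vertices of its outer triangle are in `S`
(`IsCompletion.two_outer_of_card_innerTrace_eq_two`). Both are finite checks in the icosahedron.
If `m` copies have exactly two and `u ∈ S`, then each of these `m` copies contains some `p_j ∈ S`,
and every `p_j` lies in at most two copies, so that `|S| ≥ 1 + m / 2 + 3 k - m ≥ 2 k + k / 2 + 1`;
if `u ∉ S`, each of them has both of its `p_j` in `S`, which gives the same bound. A set `S` that
misses the outer cycle can only be connected and dominating if `k = 1`, and then `|S| ≥ 4`
(`IsCompletion.four_le_card_of_outer`). Taking `u`, the `p_j` with `j` odd, and two inner vertices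
of each copy attains the bound (`IsCompletion.exists_isConnectedDominatingSet`).

The existence of completions is shown for the graph with all chords from `p₀`, drawn with the
triangles `p₀ p_{j+1} p_j` and `u p_k p₀` outside of the icosahedra. A drawing with triangular
faces is given by the map taking a dart to the third vertex of its face
(`SimpleGraph.IsTriangularFaceMap`). Its face permutation has only cycles of length three, so that
Euler's formula amounts to `E = 3 V - 6`, which holds because `V = 10 k + 2` and `E = 30 k`; what
has to be checked is that the rotation around each vertex is a single cycle (`sameRotation`).
Maximality also follows from Euler's formula: every face of a connected simple graph with minimum
degree at least two has at least three darts, hence `E ≤ 3 V - 6` if the graph is planar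
(`SimpleGraph.IsPlanar.natCard_edgeSet_add_six_le`).
-/

/-! ### Rotation systems and triangular faces -/

namespace SimpleGraph

variable {V : Type*} {G : SimpleGraph V}

/-- `third` names the faces of a drawing of `G` all of whose faces are triangles: the face to which
the dart from `x` to `y` belongs is traversed as `x`, `y`, `third x y`. The second condition
says that the next dart of that face leads on to `x`. -/
def IsTriangularFaceMap (G : SimpleGraph V) (third : V → V → V) : Prop :=
  ∀ x y, G.Adj x y → G.Adj y (third x y) ∧ third y (third x y) = x

namespace IsTriangularFaceMap

variable {third : V → V → V}

theorem adj_right (h : G.IsTriangularFaceMap third) {x y : V} (hxy : G.Adj x y) :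
    G.Adj y (third x y) :=
  (h x y hxy).1

theorem adj_left (h : G.IsTriangularFaceMap third) {x y : V} (hxy : G.Adj x y) :
    G.Adj (third x y) x := by
  have h1 := h y _ (h.adj_right hxy)
  rw [(h x y hxy).2] at h1
  exact h1.1

theorem third_third (h : G.IsTriangularFaceMap third) {x y : V} (hxy : G.Adj x y) :
    third (third x y) x = y := by
  have h1 := h y _ (h.adj_right hxy)
  rw [(h x y hxy).2] at h1
  exact h1.2

/-- The permutation of the darts that turns the triangular faces. -/
def turnFace (h : G.IsTriangularFaceMap third) : Equiv.Perm G.Dart where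
  toFun d := ⟨(d.snd, third d.fst d.snd), h.adj_right d.adj⟩
  invFun d := ⟨(third d.fst d.snd, d.fst), h.adj_left d.adj⟩
  left_inv d := by
    ext
    · exact (h _ _ d.adj).2
    · rfl
  right_inv d := by
    ext
    · rfl
    · exact h.third_third d.adj

/-- The rotation at `x` belonging to triangular faces: the edge to `y` is followed by the other edge
at `x` of the face which traverses `y`, `x`. -/
def rotation (h : G.IsTriangularFaceMap third) : Equiv.Perm G.Dart :=
  (Dart.symm_involutive (G := G)).toPerm.trans h.turnFace

/-- The rotation system of a triangular face map, provided that the faces around every vertex form a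
single cycle. -/
def rotationSystem (h : G.IsTriangularFaceMap third)
    (hc : ∀ d e : G.Dart, d.fst = e.fst → h.rotation.SameCycle d e) : G.RotationSystem where
  next := h.rotation
  fst_next _ := rfl
  sameCycle := hc

theorem facePerm_rotationSystem (h : G.IsTriangularFaceMap third)
    (hc : ∀ d e : G.Dart, d.fst = e.fst → h.rotation.SameCycle d e) :
    (h.rotationSystem hc).facePerm = h.turnFace := by
  ext d : 1
  exact congrArg h.turnFace d.symm_symm

end IsTriangularFaceMap

/-- If no point returns to itself in one or two steps, then every cycle has at least three
points. -/
theorem _root_.Equiv.Perm.three_mul_card_quotient_sameCycle_le {α : Type*} [Finite α]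
    (f : Equiv.Perm α) (h1 : ∀ x, f x ≠ x) (h2 : ∀ x, f (f x) ≠ x) :
    3 * Nat.card (Quotient (Equiv.Perm.SameCycle.setoid f)) ≤ Nat.card α := by
  classical
  have : Fintype α := Fintype.ofFinite α
  have := Fintype.ofFinite (Quotient (Equiv.Perm.SameCycle.setoid f))
  rw [Nat.card_eq_fintype_card, Nat.card_eq_fintype_card, ← Finset.card_univ, ← Finset.card_univ]
  refine Finset.mul_card_image_le_card_of_maps_to
    (f := Quotient.mk (Equiv.Perm.SameCycle.setoid f)) (fun _ _ => Finset.mem_univ _) 3 ?_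
  rintro q -
  obtain ⟨x, rfl⟩ := Quotient.exists_rep q
  have h3 : ({x, f x, f (f x)} : Finset α).card = 3 := Finset.card_eq_three.2
    ⟨x, f x, f (f x), (h1 x).symm, (h2 x).symm, fun h => h1 x (f.injective h).symm, rfl⟩
  rw [← h3]
  refine Finset.card_le_card fun y hy => Finset.mem_filter.2 ⟨Finset.mem_univ _, Quotient.sound ?_⟩
  simp only [Finset.mem_insert, Finset.mem_singleton] at hy
  change f.SameCycle y x
  rcases hy with rfl | rfl | rfl <;> simp [Equiv.Perm.SameCycle.refl]

/-- If every point returns to itself in three steps, then every cycle has at most three points. -/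
theorem _root_.Equiv.Perm.card_le_three_mul_card_quotient_sameCycle {α : Type*} [Finite α]
    (f : Equiv.Perm α) (h3 : ∀ x, f (f (f x)) = x) :
    Nat.card α ≤ 3 * Nat.card (Quotient (Equiv.Perm.SameCycle.setoid f)) := by
  classical
  have : Fintype α := Fintype.ofFinite α
  have := Fintype.ofFinite (Quotient (Equiv.Perm.SameCycle.setoid f))
  rw [Nat.card_eq_fintype_card, Nat.card_eq_fintype_card, ← Finset.card_univ, ← Finset.card_univ]
  refine Finset.card_le_mul_card_image_of_maps_to
    (f := Quotient.mk (Equiv.Perm.SameCycle.setoid f)) (fun _ _ => Finset.mem_univ _) 3 ?_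
  rintro q -
  obtain ⟨x, rfl⟩ := Quotient.exists_rep q
  refine le_trans (Finset.card_le_card fun y hy => ?_) (Finset.card_le_three (a := x) (b := f x)
    (c := f (f x)))
  have hxy : f.SameCycle x y := (Quotient.exact (Finset.mem_filter.1 hy).2 : f.SameCycle y x).symm
  obtain ⟨n, rfl⟩ := hxy.exists_nat_pow_eq
  clear hy hxy
  induction n with
  | zero => simp
  | succ n ih =>
    rw [pow_succ', Equiv.Perm.mul_apply]
    simp only [Finset.mem_insert, Finset.mem_singleton] at ih ⊢
    rcases ih with h | h | h <;> simp [h, h3]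

/-! ### Euler's formula and the number of edges -/

theorem natCard_dart [Finite V] (G : SimpleGraph V) :
    Nat.card G.Dart = 2 * Nat.card G.edgeSet := by
  classical
  have := Fintype.ofFinite V
  rw [Nat.card_eq_fintype_card, G.dart_card_eq_twice_card_edges, Nat.card_eq_fintype_card,
    ← edgeFinset_card]

instance [Finite V] : Finite G.Dart :=
  Finite.of_injective _ Dart.toProd_injective

theorem Connected.natCard_connectedComponent (h : G.Connected) :
    Nat.card G.ConnectedComponent = 1 := by
  have := h.nonempty
  have := h.preconnected.subsingleton_connectedComponent
  exact Nat.card_eq_one_iff_unique.2 ⟨this, ⟨G.connectedComponentMk h.nonempty.some⟩⟩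

theorem natCard_isolated_eq_zero (h : ∀ v, ∃ w, G.Adj v w) :
    Nat.card {v : V // ∀ w, ¬ G.Adj v w} = 0 := by
  have : IsEmpty {v : V // ∀ w, ¬ G.Adj v w} := ⟨fun v => (h v.1).elim v.2⟩
  exact Nat.card_of_isEmpty

/-- A connected graph drawn with triangular faces only is drawn on the sphere if it has `3 V - 6`
edges. -/
theorem IsTriangularFaceMap.isPlanar [Finite V] {third : V → V → V}
    (h : G.IsTriangularFaceMap third)
    (hc : ∀ d e : G.Dart, d.fst = e.fst → h.rotation.SameCycle d e)
    (hconn : G.Connected) (hiso : ∀ v, ∃ w, G.Adj v w)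
    (hE : Nat.card G.edgeSet + 6 = 3 * Nat.card V) : G.IsPlanar := by
  refine ⟨h.rotationSystem hc, ?_⟩
  rw [natCard_isolated_eq_zero hiso, hconn.natCard_connectedComponent]
  have hF : Nat.card (h.rotationSystem hc).Face =
      Nat.card (Quotient (Equiv.Perm.SameCycle.setoid h.turnFace)) := by
    rw [RotationSystem.Face, h.facePerm_rotationSystem hc]
  have hturn : ∀ d, h.turnFace (h.turnFace (h.turnFace d)) = d := by
    intro d
    ext
    · exact (h _ _ d.adj).2
    · exact (h _ _ (h.adj_right d.adj)).2
  have hle := h.turnFace.card_le_three_mul_card_quotient_sameCycle hturn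
  have hge := h.turnFace.three_mul_card_quotient_sameCycle_le
    (fun d hd => d.adj.ne (congrArg (fun e : G.Dart => e.fst) hd).symm)
    (fun d hd => (h.adj_left d.adj).ne (congrArg (fun e : G.Dart => e.fst) hd))
  have := G.natCard_dart
  omega

/-- In a rotation system, a face with two darts only occurs where two vertices of degree one are
joined by an edge. -/
theorem RotationSystem.facePerm_facePerm_ne (R : G.RotationSystem)
    (hdeg : ∀ v, ∃ w w', w ≠ w' ∧ G.Adj v w ∧ G.Adj v w') (d : G.Dart) :
    R.facePerm (R.facePerm d) ≠ d := by
  intro hd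
  have hf : ∀ d, R.facePerm d = R.next d.symm := fun _ => rfl
  -- The second dart goes back to the tail of the first, so it is its reverse.
  have h1 : R.facePerm d = d.symm := by
    have e1 : (R.facePerm d).fst = d.snd := R.fst_next d.symm
    have e2 : (R.facePerm d).snd = d.fst := by
      have := R.fst_next (R.facePerm d).symm
      rw [← hf, hd] at this
      exact this.symm
    ext
    · exact e1
    · exact e2
  rw [hf] at h1
  obtain ⟨w, w', hne, hw, hw'⟩ := hdeg d.snd
  have key : ∀ x (hx : G.Adj d.snd x), x = d.fst := by
    intro x hx
    have := (R.sameCycle d.symm ⟨(d.snd, x), hx⟩ rfl).eq_of_left h1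
    exact (congrArg (fun e : G.Dart => e.snd) this).symm
  exact hne ((key w hw).trans (key w' hw').symm)

/-- A connected planar graph without vertices of degree at most one has at most `3 V - 6` edges. -/
theorem IsPlanar.natCard_edgeSet_add_six_le [Finite V] (h : G.IsPlanar) (hconn : G.Connected)
    (hdeg : ∀ v, ∃ w w', w ≠ w' ∧ G.Adj v w ∧ G.Adj v w') :
    Nat.card G.edgeSet + 6 ≤ 3 * Nat.card V := by
  obtain ⟨R, hR⟩ := h
  rw [natCard_isolated_eq_zero fun v => ⟨_, (hdeg v).choose_spec.choose_spec.2.1⟩,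
    hconn.natCard_connectedComponent] at hR
  have hF := R.facePerm.three_mul_card_quotient_sameCycle_le
    (fun d hd => d.adj.ne <| by
      have : (R.facePerm d).fst = d.snd := R.fst_next d.symm
      rw [hd] at this
      exact this)
    (R.facePerm_facePerm_ne hdeg)
  rw [G.natCard_dart] at hF
  change 3 * Nat.card R.Face ≤ _ at hF
  omega

/-- A planar graph with `3 V - 6` edges is maximal planar. -/
theorem IsPlanar.isTriangulation [Finite V] (h : G.IsPlanar) (hconn : G.Connected)
    (hdeg : ∀ v, ∃ w w', w ≠ w' ∧ G.Adj v w ∧ G.Adj v w')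
    (hE : Nat.card G.edgeSet + 6 = 3 * Nat.card V) : G.IsTriangulation := by
  classical
  refine ⟨h, fun x y hxy hadj hpl => ?_⟩
  have := Fintype.ofFinite V
  have hle := hpl.natCard_edgeSet_add_six_le (hconn.mono le_sup_left) fun v => by
    obtain ⟨w, w', hne, hw, hw'⟩ := hdeg v
    exact ⟨w, w', hne, Or.inl hw, Or.inl hw'⟩
  have hcard := G.card_edgeFinset_sup_edge hadj hxy
  rw [Nat.card_eq_fintype_card, ← edgeFinset_card] at hle hE
  omega

end SimpleGraph

/-! ### Adjacency in the glued icosahedra -/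

instance icosahedron.decidableRelAdj : DecidableRel icosahedron.Adj := fun a b =>
  inferInstanceAs (Decidable (a ≠ b ∧
    ((a, b) ∈ icosahedronEdges ∨ (b, a) ∈ icosahedronEdges)))

/-- The nine vertices of the icosahedron off its outer triangle. -/
def innerVertex (m : Fin 9) : Fin 12 := ⟨m + 3, by omega⟩

/-- The copy of `innerVertex m` in the `i`-th icosahedron. -/
def innerCopy {k : ℕ} (i : Fin k) (m : Fin 9) : GluedVertex k := Sum.inr (Sum.inr (i, m))

theorem eq_outer_or_innerVertex :
    ∀ a : Fin 12, a = 0 ∨ a = 1 ∨ a = 2 ∨ ∃ m, a = innerVertex m := by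
  decide

theorem innerVertex_not_outer :
    ∀ m : Fin 9, ¬ (innerVertex m = 0 ∨ innerVertex m = 1 ∨ innerVertex m = 2) := by
  decide

theorem innerVertex_injective : Function.Injective innerVertex := by
  decide

section

variable {k : ℕ}

@[simp] theorem copyVertex_zero (i : Fin k) : copyVertex i 0 = hub k := rfl

@[simp] theorem copyVertex_one (i : Fin k) : copyVertex i 1 = rim i.castSucc := rfl

@[simp] theorem copyVertex_two (i : Fin k) : copyVertex i 2 = rim i.succ := rfl

@[simp] theorem copyVertex_innerVertex (i : Fin k) (m : Fin 9) :
    copyVertex i (innerVertex m) = innerCopy i m := by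
  have h := innerVertex_not_outer m
  push Not at h
  have h3 : ∀ m, Fin.ofNat 9 ((innerVertex m).val - 3) = m := by decide
  rw [copyVertex, if_neg h.1, if_neg h.2.1, if_neg h.2.2, h3, innerCopy]

theorem rim_injective : Function.Injective (rim (k := k)) := fun _ _ h =>
  Sum.inl_injective (Sum.inr_injective h)

@[simp] theorem rim_inj {j j' : Fin (k + 1)} : rim j = rim j' ↔ j = j' := rim_injective.eq_iff

@[simp] theorem innerCopy_inj {i i' : Fin k} {m m' : Fin 9} :
    innerCopy i m = innerCopy i' m' ↔ i = i' ∧ m = m' := by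
  simp [innerCopy]

@[simp] theorem hub_ne_rim (j : Fin (k + 1)) : hub k ≠ rim j := nofun
@[simp] theorem rim_ne_hub (j : Fin (k + 1)) : rim j ≠ hub k := nofun
@[simp] theorem hub_ne_innerCopy (i : Fin k) (m : Fin 9) : hub k ≠ innerCopy i m := nofun
@[simp] theorem innerCopy_ne_hub (i : Fin k) (m : Fin 9) : innerCopy i m ≠ hub k := nofun
@[simp] theorem rim_ne_innerCopy (j : Fin (k + 1)) (i : Fin k) (m : Fin 9) :
    rim j ≠ innerCopy i m := nofun
@[simp] theorem innerCopy_ne_rim (j : Fin (k + 1)) (i : Fin k) (m : Fin 9) :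
    innerCopy i m ≠ rim j := nofun

theorem gluedVertex_cases (x : GluedVertex k) :
    x = hub k ∨ (∃ j, x = rim j) ∨ ∃ i m, x = innerCopy i m := by
  rcases x with _ | j | ⟨i, m⟩
  · exact Or.inl rfl
  · exact Or.inr (Or.inl ⟨j, rfl⟩)
  · exact Or.inr (Or.inr ⟨i, m, rfl⟩)

theorem copyVertex_injective (i : Fin k) : Function.Injective (copyVertex i) := by
  intro a b h
  rcases eq_outer_or_innerVertex a with rfl | rfl | rfl | ⟨m, rfl⟩ <;>
  rcases eq_outer_or_innerVertex b with rfl | rfl | rfl | ⟨n, rfl⟩ <;>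
  simp [Fin.ext_iff] at h ⊢
  rw [Fin.ext h]

theorem gluedIcosahedra_adj {x y : GluedVertex k} :
    (gluedIcosahedra k).Adj x y ↔
      ∃ i a b, icosahedron.Adj a b ∧ copyVertex i a = x ∧ copyVertex i b = y := by
  rw [gluedIcosahedra, SimpleGraph.iSup_adj]
  exact exists_congr fun i =>
    SimpleGraph.map_adj ⟨copyVertex i, copyVertex_injective i⟩ icosahedron x y

theorem gluedIcosahedra_adj_copyVertex (i : Fin k) {a b : Fin 12} (h : icosahedron.Adj a b) :
    (gluedIcosahedra k).Adj (copyVertex i a) (copyVertex i b) :=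
  gluedIcosahedra_adj.2 ⟨i, a, b, h, rfl, rfl⟩

/-- The neighbours of an inner vertex lie in its copy of the icosahedron. -/
theorem gluedIcosahedra_adj_inner {i : Fin k} {m : Fin 9} {y : GluedVertex k} :
    (gluedIcosahedra k).Adj (innerCopy i m) y ↔
      ∃ b, icosahedron.Adj (innerVertex m) b ∧ copyVertex i b = y := by
  rw [gluedIcosahedra_adj]
  constructor
  · rintro ⟨i', a, b, h, ha, rfl⟩
    rcases eq_outer_or_innerVertex a with rfl | rfl | rfl | ⟨n, rfl⟩ <;> simp at ha
    obtain ⟨rfl, rfl⟩ := ha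
    exact ⟨b, h, rfl⟩
  · rintro ⟨b, h, rfl⟩
    exact ⟨i, _, b, h, by simp, rfl⟩

theorem gluedIcosahedra_adj_hub_inner (i : Fin k) (m : Fin 9) :
    (gluedIcosahedra k).Adj (hub k) (innerCopy i m) ↔ icosahedron.Adj (innerVertex m) 0 := by
  rw [SimpleGraph.adj_comm, gluedIcosahedra_adj_inner]
  constructor
  · rintro ⟨b, h, hb⟩
    rwa [copyVertex_injective i (hb.trans (copyVertex_zero i).symm)] at h
  · exact fun h => ⟨0, h, rfl⟩

theorem gluedIcosahedra_adj_inner_inner (i i' : Fin k) (m m' : Fin 9) :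
    (gluedIcosahedra k).Adj (innerCopy i m) (innerCopy i' m') ↔
      i = i' ∧ icosahedron.Adj (innerVertex m) (innerVertex m') := by
  rw [gluedIcosahedra_adj_inner]
  constructor
  · rintro ⟨b, h, hb⟩
    rcases eq_outer_or_innerVertex b with rfl | rfl | rfl | ⟨n, rfl⟩ <;> simp at hb
    obtain ⟨rfl, rfl⟩ := hb
    exact ⟨rfl, h⟩
  · rintro ⟨rfl, h⟩
    exact ⟨_, h, by simp⟩

theorem gluedIcosahedra_adj_rim_inner (j : Fin (k + 1)) (i : Fin k) (m : Fin 9) :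
    (gluedIcosahedra k).Adj (rim j) (innerCopy i m) ↔
      (j = i.castSucc ∧ icosahedron.Adj (innerVertex m) 1) ∨
      (j = i.succ ∧ icosahedron.Adj (innerVertex m) 2) := by
  rw [SimpleGraph.adj_comm, gluedIcosahedra_adj_inner]
  constructor
  · rintro ⟨b, h, hb⟩
    rcases eq_outer_or_innerVertex b with rfl | rfl | rfl | ⟨n, rfl⟩ <;> simp at hb
    · exact Or.inl ⟨hb.symm, h⟩
    · exact Or.inr ⟨hb.symm, h⟩
  · rintro (⟨rfl, h⟩ | ⟨rfl, h⟩)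
    · exact ⟨1, h, rfl⟩
    · exact ⟨2, h, rfl⟩

theorem gluedIcosahedra_adj_hub_rim (hk : 1 ≤ k) (j : Fin (k + 1)) :
    (gluedIcosahedra k).Adj (hub k) (rim j) := by
  rcases j with ⟨j, hj⟩
  rw [gluedIcosahedra_adj]
  by_cases h : j < k
  · exact ⟨⟨j, h⟩, 0, 1, by decide, rfl, rfl⟩
  · refine ⟨⟨k - 1, by omega⟩, 0, 2, by decide, rfl, ?_⟩
    simp [Fin.ext_iff]
    omega

theorem gluedIcosahedra_adj_rim_rim (j j' : Fin (k + 1)) :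
    (gluedIcosahedra k).Adj (rim j) (rim j') ↔ j.val + 1 = j'.val ∨ j'.val + 1 = j.val := by
  rw [gluedIcosahedra_adj]
  constructor
  · rintro ⟨i, a, b, h, ha, hb⟩
    rcases eq_outer_or_innerVertex a with rfl | rfl | rfl | ⟨m, rfl⟩ <;>
    rcases eq_outer_or_innerVertex b with rfl | rfl | rfl | ⟨n, rfl⟩ <;>
    simp at ha hb h <;> subst ha <;> subst hb <;> simp
  · rintro (h | h)
    · exact ⟨⟨j, by omega⟩, 1, 2, by decide, rfl, by simp [h]⟩
    · exact ⟨⟨j', by omega⟩, 2, 1, by decide, by simp [h], rfl⟩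

end

/-! ### A completion of the glued icosahedra -/

/-- The faces of the icosahedron other than its outer face, all in the same orientation. -/
def icosahedronFaces : List (Fin 12 × Fin 12 × Fin 12) :=
  [(0, 1, 3), (0, 3, 8), (0, 7, 2), (0, 8, 7), (1, 4, 3), (1, 5, 4), (2, 5, 1), (2, 6, 5),
   (2, 7, 6), (3, 4, 9), (3, 9, 8), (4, 10, 9), (5, 10, 4), (6, 10, 5), (6, 11, 10), (7, 11, 6),
   (8, 9, 11), (8, 11, 7), (9, 10, 11)]

/-- The third vertex of the face in `icosahedronFaces` which traverses `a`, `b`; the junk value `0`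
if there is none. -/
def icosahedronThird (a b : Fin 12) : Fin 12 :=
  (icosahedronFaces.filterMap fun f =>
    if (a, b) = (f.1, f.2.1) then some f.2.2
    else if (a, b) = (f.2.1, f.2.2) then some f.1
    else if (a, b) = (f.2.2, f.1) then some f.2.1
    else none).headD 0

/-- `a`, `b` is a dart of the icosahedron that does not belong to the outer face. -/
def IsInnerDart (a b : Fin 12) : Prop :=
  icosahedron.Adj a b ∧ (a, b) ≠ (1, 0) ∧ (a, b) ≠ (0, 2) ∧ (a, b) ≠ (2, 1)

instance : DecidableRel IsInnerDart := fun _ _ => inferInstanceAs (Decidable (_ ∧ _))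

theorem IsInnerDart.third : ∀ {a b : Fin 12}, IsInnerDart a b →
    IsInnerDart b (icosahedronThird a b) ∧
      icosahedronThird b (icosahedronThird a b) = a := by
  decide +kernel

/-- The neighbour of `a` in the icosahedron from which the rotation about `a` reaches all the
others without crossing the outer face. -/
def rotationStart (a : Fin 12) : Fin 12 :=
  if a = 0 then 2 else if a = 1 then 0 else if a = 2 then 1 else
    ((List.finRange 12).filter fun b => icosahedron.Adj a b).headD 0

/-- Around each vertex of the icosahedron, the inner faces turn from `rotationStart a` to any other
neighbour. -/
theorem exists_rotation_eq : ∀ {a b : Fin 12}, icosahedron.Adj a b →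
    ∃ n < 5, (fun c => icosahedronThird c a)^[n] (rotationStart a) = b ∧
      ∀ l < n, IsInnerDart ((fun c => icosahedronThird c a)^[l] (rotationStart a)) a := by
  decide +kernel

theorem adj_rotationStart : ∀ a : Fin 12, icosahedron.Adj a (rotationStart a) := by
  decide +kernel

/-- The chords from `p₀` to all other vertices `p_j`. -/
def rimFan (k : ℕ) : SimpleGraph (GluedVertex k) :=
  SimpleGraph.fromRel fun x y => x = rim 0 ∧ ∃ j, y = rim j

/-- The completion of the glued icosahedra by all chords from `p₀`. -/
def fanCompletion (k : ℕ) : SimpleGraph (GluedVertex k) :=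
  gluedIcosahedra k ⊔ rimFan k

section

variable {k : ℕ}

theorem rimFan_adj {x y : GluedVertex k} :
    (rimFan k).Adj x y ↔
      ∃ j, j ≠ 0 ∧ ((x = rim 0 ∧ y = rim j) ∨ (x = rim j ∧ y = rim 0)) := by
  rw [rimFan, SimpleGraph.fromRel_adj]
  constructor
  · rintro ⟨hne, ⟨rfl, j, rfl⟩ | ⟨rfl, j, rfl⟩⟩
    · exact ⟨j, fun h => hne (by rw [h]), Or.inl ⟨rfl, rfl⟩⟩
    · exact ⟨j, fun h => hne (by rw [h]), Or.inr ⟨rfl, rfl⟩⟩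
  · rintro ⟨j, hj, ⟨rfl, rfl⟩ | ⟨rfl, rfl⟩⟩
    · exact ⟨by simpa using hj.symm, Or.inl ⟨rfl, j, rfl⟩⟩
    · exact ⟨by simpa using hj, Or.inr ⟨rfl, j, rfl⟩⟩

/-- The faces of `fanCompletion k` outside of the icosahedra, each with one choice of its
first vertex. -/
inductive IsOuterFace (k : ℕ) : GluedVertex k → GluedVertex k → GluedVertex k → Prop
  | hub : IsOuterFace k (hub k) (rim (Fin.last k)) (rim 0)
  | fan (j : ℕ) (h0 : 0 < j) (hj : j < k) :
      IsOuterFace k (rim 0) (rim ⟨j + 1, by omega⟩) (rim ⟨j, by omega⟩)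

/-- Every dart of `fanCompletion k` belongs to a face inside of one of the icosahedra or to one of
the faces outside of them. -/
theorem fanCompletion_dart_cases (hk : 1 ≤ k) {x y : GluedVertex k}
    (h : (fanCompletion k).Adj x y) :
    (∃ i a b, IsInnerDart a b ∧ copyVertex i a = x ∧ copyVertex i b = y) ∨
      ∃ z, IsOuterFace k x y z ∨ IsOuterFace k y z x ∨ IsOuterFace k z x y := by
  rcases h with h | h
  · obtain ⟨i, a, b, hab, rfl, rfl⟩ := gluedIcosahedra_adj.1 h
    obtain ⟨i, hi⟩ := i
    by_cases h10 : (a, b) = (1, 0)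
    · obtain ⟨rfl, rfl⟩ := Prod.ext_iff.1 h10
      rcases i with _ | i
      · exact Or.inr ⟨_, Or.inr (Or.inl .hub)⟩
      · exact Or.inl ⟨⟨i, by omega⟩, 2, 0, by decide, rfl, rfl⟩
    by_cases h02 : (a, b) = (0, 2)
    · obtain ⟨rfl, rfl⟩ := Prod.ext_iff.1 h02
      by_cases hi' : i + 1 = k
      · subst hi'
        exact Or.inr ⟨_, Or.inl .hub⟩
      · exact Or.inl ⟨⟨i + 1, by omega⟩, 0, 1, by decide, rfl, rfl⟩
    by_cases h21 : (a, b) = (2, 1)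
    · obtain ⟨rfl, rfl⟩ := Prod.ext_iff.1 h21
      rcases i with _ | i
      · by_cases hk1 : k = 1
        · subst hk1
          exact Or.inr ⟨_, Or.inr (Or.inr .hub)⟩
        · exact Or.inr ⟨_, Or.inr (Or.inl (.fan 1 one_pos (by omega)))⟩
      · exact Or.inr ⟨_, Or.inr (Or.inr (.fan (i + 1) (by omega) hi))⟩
    exact Or.inl ⟨⟨i, hi⟩, a, b, ⟨hab, h10, h02, h21⟩, rfl, rfl⟩
  · obtain ⟨⟨j, hj⟩, hj0, ⟨rfl, rfl⟩ | ⟨rfl, rfl⟩⟩ := rimFan_adj.1 h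
    · rcases j with _ | _ | j
      · exact absurd rfl hj0
      · exact Or.inl ⟨⟨0, hk⟩, 1, 2, by decide, rfl, rfl⟩
      · exact Or.inr ⟨_, Or.inl (.fan (j + 1) (by omega) (by omega))⟩
    · rcases j with _ | j
      · exact absurd rfl hj0
      · by_cases hjk : j + 1 = k
        · subst hjk
          exact Or.inr ⟨_, Or.inr (Or.inr .hub)⟩
        · exact Or.inr ⟨_, Or.inr (Or.inl (.fan (j + 1) (by omega) (by omega)))⟩

/-- The third vertex of the face of `fanCompletion k` which traverses `x`, `y`; a junk value if
these are not adjacent. The dart from `p_j` to `u` lies in the copy before `p_j`, its reverse in the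
copy after it. Between two vertices of the rim, the dart from `p_j` to `p_{j+1}` lies in a copy, and
all others belong to the faces of `IsOuterFace`. -/
def fanThird (k : ℕ) : GluedVertex k → GluedVertex k → GluedVertex k
  | .inl _, .inl _ => hub k
  | .inl _, .inr (.inl j) =>
      if h : j.val < k then copyVertex ⟨j, h⟩ (icosahedronThird 0 1) else rim 0
  | .inr (.inl j), .inl _ =>
      if h : 0 < j.val then copyVertex ⟨j - 1, by omega⟩ (icosahedronThird 2 0)
      else rim (Fin.last k)
  | .inr (.inl j), .inr (.inl j') =>
      if h : j.val + 1 = j'.val then copyVertex ⟨j, by omega⟩ (icosahedronThird 1 2)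
      else if j.val = 0 then rim ⟨j' - 1, by omega⟩
      else if j'.val = 0 then
        if h : j.val < k then rim ⟨j + 1, by omega⟩ else hub k
      else rim 0
  | .inl _, .inr (.inr (i, m)) => copyVertex i (icosahedronThird 0 (innerVertex m))
  | .inr (.inr (i, m)), .inl _ => copyVertex i (icosahedronThird (innerVertex m) 0)
  | .inr (.inl j), .inr (.inr (i, m)) =>
      copyVertex i (icosahedronThird (if j = i.castSucc then 1 else 2) (innerVertex m))
  | .inr (.inr (i, m)), .inr (.inl j) =>
      copyVertex i (icosahedronThird (innerVertex m) (if j = i.castSucc then 1 else 2))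
  | .inr (.inr (i, m)), .inr (.inr (_, m')) =>
      copyVertex i (icosahedronThird (innerVertex m) (innerVertex m'))

theorem fanThird_copyVertex (i : Fin k) {a b : Fin 12} (h : IsInnerDart a b) :
    fanThird k (copyVertex i a) (copyVertex i b) = copyVertex i (icosahedronThird a b) := by
  have hs : i.succ ≠ i.castSucc := by simp [Fin.ext_iff]
  obtain ⟨hadj, h10, h02, h21⟩ := h
  rcases eq_outer_or_innerVertex a with rfl | rfl | rfl | ⟨m, rfl⟩ <;>
  rcases eq_outer_or_innerVertex b with rfl | rfl | rfl | ⟨n, rfl⟩ <;>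
  first
    | exact absurd rfl hadj.ne
    | exact absurd rfl h10
    | exact absurd rfl h02
    | exact absurd rfl h21
    | simp [hub, rim, innerCopy, fanThird, hs]

theorem IsOuterFace.fanThird_eq (hk : 1 ≤ k) {x y z : GluedVertex k}
    (h : IsOuterFace k x y z) :
    fanThird k x y = z ∧ fanThird k y z = x ∧ fanThird k z x = y := by
  cases h with
  | hub =>
    have : k ≠ 0 := by omega
    refine ⟨?_, ?_, ?_⟩ <;> simp [_root_.hub, rim, fanThird, this]
  | fan j h0 hj =>
    have h1 := h0.ne'
    have h2 : j + 1 + 1 ≠ j := by omega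
    refine ⟨?_, ?_, ?_⟩ <;> simp [rim, fanThird, h1, h2, hj]

theorem IsOuterFace.adj (hk : 1 ≤ k) {x y z : GluedVertex k} (h : IsOuterFace k x y z) :
    (fanCompletion k).Adj x y ∧ (fanCompletion k).Adj y z ∧ (fanCompletion k).Adj z x := by
  cases h with
  | hub =>
    refine ⟨Or.inl (gluedIcosahedra_adj_hub_rim hk _), Or.inr (rimFan_adj.2 ⟨Fin.last k, ?_, ?_⟩),
      Or.inl (gluedIcosahedra_adj_hub_rim hk _).symm⟩
    · simp [Fin.ext_iff]
      omega
    · simp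
  | fan j h0 hj =>
    refine ⟨Or.inr (rimFan_adj.2 ⟨_, ?_, Or.inl ⟨rfl, rfl⟩⟩),
      Or.inl ((gluedIcosahedra_adj_rim_rim _ _).2 (Or.inr rfl)),
      Or.inr (rimFan_adj.2 ⟨_, ?_, Or.inr ⟨rfl, rfl⟩⟩)⟩
    · simp [Fin.ext_iff]
    · simp [Fin.ext_iff]
      omega

theorem isTriangularFaceMap_fanThird (hk : 1 ≤ k) :
    (fanCompletion k).IsTriangularFaceMap (fanThird k) := by
  intro x y h
  rcases fanCompletion_dart_cases hk h with ⟨i, a, b, hab, rfl, rfl⟩ | ⟨z, hz | hz | hz⟩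
  · rw [fanThird_copyVertex i hab, fanThird_copyVertex i hab.third.1, hab.third.2]
    exact ⟨Or.inl (gluedIcosahedra_adj_copyVertex i hab.third.1.1), rfl⟩
  · rw [(hz.fanThird_eq hk).1, (hz.fanThird_eq hk).2.1]
    exact ⟨(hz.adj hk).2.1, rfl⟩
  · rw [(hz.fanThird_eq hk).2.2, (hz.fanThird_eq hk).1]
    exact ⟨(hz.adj hk).1, rfl⟩
  · rw [(hz.fanThird_eq hk).2.1, (hz.fanThird_eq hk).2.2]
    exact ⟨(hz.adj hk).2.2, rfl⟩

end

/-! ### The rotation around the vertices of the completion -/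

section

variable {k : ℕ}

/-- The edges from `x` to `y` and to `y'` lie in the same cycle of the rotation around `x`. -/
def SameRotation (hk : 1 ≤ k) (x y y' : GluedVertex k) : Prop :=
  ∃ (h : (fanCompletion k).Adj x y) (h' : (fanCompletion k).Adj x y'),
    (isTriangularFaceMap_fanThird hk).rotation.SameCycle ⟨(x, y), h⟩ ⟨(x, y'), h'⟩

namespace SameRotation

variable {hk : 1 ≤ k} {x y y' y'' : GluedVertex k}

theorem refl (h : (fanCompletion k).Adj x y) : SameRotation hk x y y :=
  ⟨h, h, .refl _ _⟩

theorem symm : SameRotation hk x y y' → SameRotation hk x y' y :=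
  fun ⟨h, h', hs⟩ => ⟨h', h, hs.symm⟩

theorem trans : SameRotation hk x y y' → SameRotation hk x y' y'' → SameRotation hk x y y'' :=
  fun ⟨h, _, hs⟩ ⟨_, h', hs'⟩ => ⟨h, h', hs.trans hs'⟩

theorem fanThird (h : (fanCompletion k).Adj x y) :
    SameRotation hk x y (_root_.fanThird k y x) :=
  ⟨h, (isTriangularFaceMap_fanThird hk).adj_right h.symm,
    Equiv.Perm.sameCycle_apply_right.2 (.refl _ _)⟩

end SameRotation

theorem fanCompletion_adj_copyVertex (i : Fin k) {a b : Fin 12} (h : icosahedron.Adj a b) :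
    (fanCompletion k).Adj (copyVertex i a) (copyVertex i b) :=
  Or.inl (gluedIcosahedra_adj_copyVertex i h)

theorem sameRotation_copyVertex_start (hk : 1 ≤ k) (i : Fin k) {a b : Fin 12}
    (h : icosahedron.Adj a b) :
    SameRotation hk (copyVertex i a) (copyVertex i (rotationStart a)) (copyVertex i b) := by
  obtain ⟨n, -, rfl, hn⟩ := exists_rotation_eq h
  clear h
  induction n with
  | zero => exact .refl (fanCompletion_adj_copyVertex i (adj_rotationStart a))
  | succ n ih =>
    have hd := hn n n.lt_succ_self
    rw [Function.iterate_succ_apply', ← fanThird_copyVertex i hd]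
    exact (ih fun l hl => hn l (hl.trans n.lt_succ_self)).trans
      (.fanThird (fanCompletion_adj_copyVertex i hd.1.symm))

theorem sameRotation_copyVertex (hk : 1 ≤ k) (i : Fin k) {a b c : Fin 12}
    (hb : icosahedron.Adj a b) (hc : icosahedron.Adj a c) :
    SameRotation hk (copyVertex i a) (copyVertex i b) (copyVertex i c) :=
  (sameRotation_copyVertex_start hk i hb).symm.trans (sameRotation_copyVertex_start hk i hc)

theorem sameRotation_hub_rim (hk : 1 ≤ k) (j : Fin (k + 1)) :
    SameRotation hk (hub k) (rim 0) (rim j) := by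
  induction j using Fin.induction with
  | zero => exact .refl (Or.inl (gluedIcosahedra_adj_hub_rim hk 0))
  | succ i ih => exact ih.trans (sameRotation_copyVertex hk i (a := 0) (b := 1) (c := 2)
      (by decide) (by decide))

theorem sameRotation_hub (hk : 1 ≤ k) {y : GluedVertex k} (h : (fanCompletion k).Adj (hub k) y) :
    SameRotation hk (hub k) (rim 0) y := by
  rcases h with h | h
  · obtain ⟨i, a, b, hab, ha, rfl⟩ := gluedIcosahedra_adj.1 h
    obtain rfl : a = 0 := copyVertex_injective i (ha.trans (copyVertex_zero i).symm)
    exact (sameRotation_hub_rim hk i.castSucc).trans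
      (sameRotation_copyVertex hk i (a := 0) (b := 1) (by decide) hab)
  · obtain ⟨j, -, ⟨h, -⟩ | ⟨h, -⟩⟩ := rimFan_adj.1 h
    · exact absurd h (hub_ne_rim _)
    · exact absurd h (hub_ne_rim _)

theorem sameRotation_rim_of_glued (hk : 1 ≤ k) {j : Fin (k + 1)} {y : GluedVertex k}
    (h : (gluedIcosahedra k).Adj (rim j) y) : SameRotation hk (rim j) (hub k) y := by
  obtain ⟨i, a, b, hab, ha, rfl⟩ := gluedIcosahedra_adj.1 h
  rcases eq_outer_or_innerVertex a with rfl | rfl | rfl | ⟨m, rfl⟩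
  · simp at ha
  · rw [← ha]
    exact sameRotation_copyVertex hk i (a := 1) (b := 0) (by decide) hab
  · rw [← ha]
    exact sameRotation_copyVertex hk i (a := 2) (b := 0) (by decide) hab
  · simp at ha

/-- Around `p₀`, the chords follow each other in increasing order. -/
theorem sameRotation_rim_zero (hk : 1 ≤ k) (j : ℕ) (h0 : 0 < j) (hj : j ≤ k) :
    SameRotation hk (rim 0) (hub k) (rim ⟨j, by omega⟩) := by
  have key {j : ℕ} (h0 : 0 < j) (hj : j ≤ k) :
      SameRotation hk (rim 0) (rim ⟨j, by omega⟩) (fanThird k (rim ⟨j, by omega⟩) (rim 0)) :=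
    .fanThird (Or.inr (rimFan_adj.2 ⟨_, fun h => h0.ne' (Fin.ext_iff.1 h), Or.inl ⟨rfl, rfl⟩⟩))
  induction hj using Nat.decreasingInduction with
  | self =>
    have h := key h0 le_rfl
    rw [show (⟨k, by omega⟩ : Fin (k + 1)) = Fin.last k from rfl,
      (IsOuterFace.hub.fanThird_eq hk).2.1] at h
    exact h.symm
  | of_succ j hj ih =>
    have h := key h0 hj.le
    rw [((IsOuterFace.fan j h0 hj).fanThird_eq hk).2.2] at h
    exact (ih j.succ_pos key).trans h.symm

theorem sameRotation_rim (hk : 1 ≤ k) {j : Fin (k + 1)} {y : GluedVertex k}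
    (h : (fanCompletion k).Adj (rim j) y) : SameRotation hk (rim j) (hub k) y := by
  rcases h with hg | hf
  · exact sameRotation_rim_of_glued hk hg
  · have h := hf
    obtain ⟨⟨j', hj'⟩, hj0, ⟨hj, rfl⟩ | ⟨hj, rfl⟩⟩ := rimFan_adj.1 hf
    · obtain rfl := rim_injective hj
      refine sameRotation_rim_zero hk j' ?_ (by omega)
      exact Nat.pos_of_ne_zero fun h => hj0 (Fin.ext h)
    · obtain rfl := rim_injective hj
      rcases j' with _ | _ | j'
      · exact absurd rfl hj0
      · exact sameRotation_rim_of_glued hk ((gluedIcosahedra_adj_rim_rim _ _).2 (Or.inr rfl))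
      · have h1 := SameRotation.fanThird (hk := hk) (Or.inr h)
        rw [((IsOuterFace.fan (j' + 1) (by omega) (by omega)).fanThird_eq hk).1] at h1
        exact (sameRotation_rim_of_glued hk
          ((gluedIcosahedra_adj_rim_rim _ _).2 (Or.inr rfl))).trans h1.symm

theorem fanCompletion_adj_innerCopy {i : Fin k} {m : Fin 9} {y : GluedVertex k} :
    (fanCompletion k).Adj (innerCopy i m) y ↔
      ∃ b, icosahedron.Adj (innerVertex m) b ∧ copyVertex i b = y := by
  rw [← gluedIcosahedra_adj_inner]
  refine or_iff_left fun h => ?_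
  obtain ⟨j, -, ⟨h, -⟩ | ⟨h, -⟩⟩ := rimFan_adj.1 h <;> simp at h

theorem sameRotation (hk : 1 ≤ k) {x y y' : GluedVertex k} (h : (fanCompletion k).Adj x y)
    (h' : (fanCompletion k).Adj x y') : SameRotation hk x y y' := by
  rcases gluedVertex_cases x with rfl | ⟨j, rfl⟩ | ⟨i, m, rfl⟩
  · exact (sameRotation_hub hk h).symm.trans (sameRotation_hub hk h')
  · exact (sameRotation_rim hk h).symm.trans (sameRotation_rim hk h')
  · obtain ⟨b, hb, rfl⟩ := fanCompletion_adj_innerCopy.1 h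
    obtain ⟨c, hc, rfl⟩ := fanCompletion_adj_innerCopy.1 h'
    rw [← copyVertex_innerVertex]
    exact sameRotation_copyVertex hk i hb hc

end

/-! ### The completion is a triangulation -/

section

variable {k : ℕ}

theorem fanCompletion_adj_rim_rim (j j' : Fin (k + 1)) :
    (fanCompletion k).Adj (rim j) (rim j') ↔
      j.val + 1 = j'.val ∨ j'.val + 1 = j.val ∨ (j.val = 0 ∧ 2 ≤ j'.val) ∨
        (j'.val = 0 ∧ 2 ≤ j.val) := by
  rw [fanCompletion, SimpleGraph.sup_adj, gluedIcosahedra_adj_rim_rim, rimFan_adj]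
  simp only [rim_inj, ne_eq]
  constructor
  · rintro (h | ⟨l, hl, ⟨rfl, rfl⟩ | ⟨rfl, rfl⟩⟩)
    · omega
    · rw [Fin.ext_iff] at hl
      rw [Fin.val_zero] at hl ⊢
      omega
    · rw [Fin.ext_iff] at hl
      rw [Fin.val_zero] at hl ⊢
      omega
  · rintro (h | h | ⟨h, h'⟩ | ⟨h, h'⟩)
    · exact Or.inl (Or.inl h)
    · exact Or.inl (Or.inr h)
    · refine Or.inr ⟨j', fun h0 => ?_, Or.inl ⟨Fin.ext h, rfl⟩⟩
      rw [h0] at h'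
      exact absurd h' (by simp)
    · refine Or.inr ⟨j, fun h0 => ?_, Or.inr ⟨rfl, Fin.ext h⟩⟩
      rw [h0] at h'
      exact absurd h' (by simp)

/-- There are `k` edges on the rim and `k - 1` chords; the sum counts darts. -/
theorem sum_adj_rim_rim (hk : 1 ≤ k) [DecidableRel (fanCompletion k).Adj] :
    (∑ j : Fin (k + 1), ∑ j' : Fin (k + 1),
      if (fanCompletion k).Adj (rim j) (rim j') then 1 else 0) + 2 = 4 * k := by
  have h (j j' : Fin (k + 1)) : (if (fanCompletion k).Adj (rim j) (rim j') then 1 else 0) =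
      (if j.val + 1 = j'.val then 1 else 0) + (if j'.val + 1 = j.val then 1 else 0) +
      (if j.val = 0 then if 2 ≤ j'.val then 1 else 0 else 0) +
      (if j'.val = 0 then if 2 ≤ j.val then 1 else 0 else 0) := by
    rw [if_congr (fanCompletion_adj_rim_rim j j') rfl rfl]
    split_ifs <;> first | rfl | (exfalso; omega)
  have h1 : (∑ j : Fin (k + 1), ∑ j' : Fin (k + 1), if j.val + 1 = j'.val then 1 else 0) = k := by
    rw [Finset.sum_congr rfl fun (j : Fin (k + 1)) _ =>
      Fin.sum_univ_eq_sum_range (fun b => if j.val + 1 = b then 1 else 0) (k + 1)]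
    rw [Fin.sum_univ_eq_sum_range
      (fun a => ∑ b ∈ Finset.range (k + 1), if a + 1 = b then 1 else 0) (k + 1)]
    rw [Finset.sum_congr rfl fun a _ => Finset.sum_ite_eq _ _ _]
    rw [Finset.sum_range_succ, Finset.sum_congr rfl fun a ha =>
      if_pos (Finset.mem_range.2 (Nat.succ_lt_succ (Finset.mem_range.1 ha)))]
    simp
  have h2 : (∑ j : Fin (k + 1), ∑ j' : Fin (k + 1),
      if j.val = 0 then if 2 ≤ j'.val then 1 else 0 else 0) = k - 1 := by
    obtain ⟨k, rfl⟩ : ∃ l, k = l + 1 := ⟨k - 1, by omega⟩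
    rw [Fin.sum_univ_succ, Fin.sum_univ_succ, Fin.sum_univ_succ]
    simp
  simp only [h, Finset.sum_add_distrib]
  rw [Finset.sum_comm (f := fun j j' : Fin (k + 1) => if j'.val + 1 = j.val then 1 else 0),
    Finset.sum_comm (f := fun j j' : Fin (k + 1) =>
      if j'.val = 0 then if 2 ≤ j.val then 1 else 0 else 0), h1, h2]
  omega

theorem fanCompletion_adj_hub_rim (hk : 1 ≤ k) (j : Fin (k + 1)) :
    (fanCompletion k).Adj (hub k) (rim j) :=
  Or.inl (gluedIcosahedra_adj_hub_rim hk j)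

theorem fanCompletion_adj_innerCopy_iff_glued {i : Fin k} {m : Fin 9} {y : GluedVertex k} :
    (fanCompletion k).Adj (innerCopy i m) y ↔ (gluedIcosahedra k).Adj (innerCopy i m) y := by
  rw [fanCompletion_adj_innerCopy, gluedIcosahedra_adj_inner]

theorem sum_adj_rim_inner [DecidableRel (fanCompletion k).Adj] :
    (∑ j : Fin (k + 1), ∑ i : Fin k, ∑ m : Fin 9,
      if (fanCompletion k).Adj (rim j) (innerCopy i m) then 1 else 0) = 6 * k := by
  have h (j : Fin (k + 1)) (i : Fin k) (m : Fin 9) :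
      (if (fanCompletion k).Adj (rim j) (innerCopy i m) then 1 else 0) =
      (if j = i.castSucc then if icosahedron.Adj (innerVertex m) 1 then 1 else 0 else 0) +
      (if j = i.succ then if icosahedron.Adj (innerVertex m) 2 then 1 else 0 else 0) := by
    have h1 : (fanCompletion k).Adj (rim j) (innerCopy i m) ↔ _ :=
      ((SimpleGraph.adj_comm _ _ _).trans (fanCompletion_adj_innerCopy_iff_glued.trans
        (SimpleGraph.adj_comm _ _ _))).trans (gluedIcosahedra_adj_rim_inner j i m)
    have h2 : j = i.castSucc → j ≠ i.succ := by
      rintro rfl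
      simp [Fin.ext_iff]
    rw [if_congr h1 rfl rfl]
    split_ifs <;> first | rfl | tauto
  have hs : ∀ i : Fin k, ∑ m : Fin 9, ∑ j : Fin (k + 1),
      (if (fanCompletion k).Adj (rim j) (innerCopy i m) then 1 else 0) = 6 := by
    intro i
    simp only [h, Finset.sum_add_distrib, Finset.sum_ite_eq', Finset.mem_univ, if_true]
    decide
  rw [Finset.sum_comm, Finset.sum_congr rfl fun i _ => Finset.sum_comm.trans (hs i)]
  simp [mul_comm]

theorem sum_adj_inner_inner [DecidableRel (fanCompletion k).Adj] :
    (∑ i : Fin k, ∑ m : Fin 9, ∑ i' : Fin k, ∑ m' : Fin 9,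
      if (fanCompletion k).Adj (innerCopy i m) (innerCopy i' m') then 1 else 0) = 36 * k := by
  have h (i i' : Fin k) (m m' : Fin 9) :
      (if (fanCompletion k).Adj (innerCopy i m) (innerCopy i' m') then 1 else 0) =
      if i = i' then if icosahedron.Adj (innerVertex m) (innerVertex m') then 1 else 0 else 0 := by
    have h1 := (fanCompletion_adj_innerCopy_iff_glued (i := i) (m := m)).trans
      (gluedIcosahedra_adj_inner_inner i i' m m')
    rw [if_congr h1 rfl rfl]
    split_ifs <;> first | rfl | tauto
  have hs (i : Fin k) (m : Fin 9) : (∑ i' : Fin k, ∑ m' : Fin 9,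
      if (fanCompletion k).Adj (innerCopy i m) (innerCopy i' m') then 1 else 0) =
      ∑ m' : Fin 9, if icosahedron.Adj (innerVertex m) (innerVertex m') then 1 else 0 := by
    rw [Finset.sum_comm]
    simp only [h, Finset.sum_ite_eq, Finset.mem_univ, if_true]
  have ht : (∑ m : Fin 9, ∑ m' : Fin 9,
      if icosahedron.Adj (innerVertex m) (innerVertex m') then 1 else 0) = 36 := by
    decide +kernel
  simp only [hs, ht]
  simp [mul_comm]

theorem sum_adj_hub_inner [DecidableRel (fanCompletion k).Adj] :
    (∑ i : Fin k, ∑ m : Fin 9,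
      if (fanCompletion k).Adj (hub k) (innerCopy i m) then 1 else 0) = 3 * k := by
  have hs (i : Fin k) : (∑ m : Fin 9,
      if (fanCompletion k).Adj (hub k) (innerCopy i m) then 1 else 0) =
      ∑ m : Fin 9, if icosahedron.Adj (innerVertex m) 0 then 1 else 0 := by
    refine Finset.sum_congr rfl fun m _ => if_congr ?_ rfl rfl
    rw [SimpleGraph.adj_comm, fanCompletion_adj_innerCopy_iff_glued, SimpleGraph.adj_comm,
      gluedIcosahedra_adj_hub_inner]
  have ht : (∑ m : Fin 9, if icosahedron.Adj (innerVertex m) 0 then 1 else 0) = 3 := by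
    decide
  simp only [hs, ht]
  simp [mul_comm]

theorem natCard_edgeSet_fanCompletion (hk : 1 ≤ k) :
    Nat.card (fanCompletion k).edgeSet = 30 * k := by
  classical
  have h := (fanCompletion k).sum_degrees_eq_twice_card_edges
  have hd : ∀ x, (fanCompletion k).degree x =
      ∑ y, if (fanCompletion k).Adj x y then 1 else 0 := by
    intro x
    rw [← SimpleGraph.card_neighborFinset_eq_degree, SimpleGraph.neighborFinset_eq_filter,
      Finset.card_filter]
  simp only [hd, Fintype.sum_sum_type, Fintype.sum_prod_type, Finset.univ_unique,
    Finset.sum_singleton, Finset.sum_add_distrib] at h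
  change (if (fanCompletion k).Adj (hub k) (hub k) then 1 else 0) +
      ((∑ j, if (fanCompletion k).Adj (rim j) (hub k) then 1 else 0) +
        ∑ i, ∑ m, if (fanCompletion k).Adj (innerCopy i m) (hub k) then 1 else 0) +
      ((∑ j, if (fanCompletion k).Adj (hub k) (rim j) then 1 else 0) +
        ((∑ j, ∑ j', if (fanCompletion k).Adj (rim j) (rim j') then 1 else 0) +
          ∑ i, ∑ m, ∑ j, if (fanCompletion k).Adj (innerCopy i m) (rim j) then 1 else 0) +
      ((∑ i, ∑ m, if (fanCompletion k).Adj (hub k) (innerCopy i m) then 1 else 0) +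
        ((∑ j, ∑ i, ∑ m, if (fanCompletion k).Adj (rim j) (innerCopy i m) then 1 else 0) +
          ∑ i, ∑ m, ∑ i', ∑ m',
            if (fanCompletion k).Adj (innerCopy i m) (innerCopy i' m') then 1 else 0))) = _ at h
  have e1 : (∑ j : Fin (k + 1), if (fanCompletion k).Adj (hub k) (rim j) then 1 else 0) =
      k + 1 := by
    simp [fanCompletion_adj_hub_rim hk]
  have e2 : (∑ j : Fin (k + 1), if (fanCompletion k).Adj (rim j) (hub k) then 1 else 0) =
      k + 1 := by
    simp [(fanCompletion_adj_hub_rim hk _).symm]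
  have e3 : (∑ i : Fin k, ∑ m : Fin 9,
      if (fanCompletion k).Adj (innerCopy i m) (hub k) then 1 else 0) = 3 * k := by
    simp only [← sum_adj_hub_inner, SimpleGraph.adj_comm]
  have e4 : (∑ i : Fin k, ∑ m : Fin 9, ∑ j : Fin (k + 1),
      if (fanCompletion k).Adj (innerCopy i m) (rim j) then 1 else 0) = 6 * k := by
    rw [← sum_adj_rim_inner, Finset.sum_comm (s := (Finset.univ : Finset (Fin (k + 1))))]
    refine Finset.sum_congr rfl fun i _ => ?_
    rw [Finset.sum_comm]
    simp only [SimpleGraph.adj_comm]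
  have e5 := sum_adj_rim_rim hk
  rw [if_neg (SimpleGraph.irrefl _), e1, e2, e3, e4, sum_adj_hub_inner, sum_adj_rim_inner,
    sum_adj_inner_inner] at h
  rw [Nat.card_eq_fintype_card, ← SimpleGraph.edgeFinset_card]
  omega

theorem natCard_gluedVertex (k : ℕ) : Nat.card (GluedVertex k) = 10 * k + 2 := by
  rw [Nat.card_eq_fintype_card]
  simp
  omega

theorem gluedIcosahedra_connected (hk : 1 ≤ k) : (gluedIcosahedra k).Connected := by
  have h0 : ∀ a, a ≠ 0 → icosahedron.Adj a 0 ∨ ∃ b, icosahedron.Adj a b ∧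
      (icosahedron.Adj b 0 ∨ ∃ c, icosahedron.Adj b c ∧ icosahedron.Adj c 0) := by
    decide +kernel
  refine (SimpleGraph.connected_iff_exists_forall_reachable _).2 ⟨hub k, fun x => ?_⟩
  rcases gluedVertex_cases x with rfl | ⟨j, rfl⟩ | ⟨i, m, rfl⟩
  · rfl
  · exact (gluedIcosahedra_adj_hub_rim hk j).reachable
  · have hm : innerVertex m ≠ 0 := fun h => absurd (congrArg Fin.val h) (by simp [innerVertex])
    rw [← copyVertex_innerVertex, ← copyVertex_zero i]
    refine SimpleGraph.Reachable.symm ?_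
    rcases h0 _ hm with h | ⟨b, hb, h | ⟨c, hc, h⟩⟩
    · exact (gluedIcosahedra_adj_copyVertex i h).reachable
    · exact (gluedIcosahedra_adj_copyVertex i hb).reachable.trans
        (gluedIcosahedra_adj_copyVertex i h).reachable
    · exact ((gluedIcosahedra_adj_copyVertex i hb).reachable.trans
        (gluedIcosahedra_adj_copyVertex i hc).reachable).trans
        (gluedIcosahedra_adj_copyVertex i h).reachable

theorem exists_copyVertex_eq (hk : 1 ≤ k) (x : GluedVertex k) : ∃ i a, copyVertex i a = x := by
  rcases gluedVertex_cases x with rfl | ⟨j, rfl⟩ | ⟨i, m, rfl⟩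
  · exact ⟨⟨0, hk⟩, 0, rfl⟩
  · obtain ⟨i, a, b, -, -, h⟩ := gluedIcosahedra_adj.1 (gluedIcosahedra_adj_hub_rim hk j)
    exact ⟨i, b, h⟩
  · exact ⟨i, _, copyVertex_innerVertex i m⟩

theorem exists_two_neighbors (hk : 1 ≤ k) (x : GluedVertex k) :
    ∃ y y', y ≠ y' ∧ (fanCompletion k).Adj x y ∧ (fanCompletion k).Adj x y' := by
  have h : ∀ a, ∃ b c, b ≠ c ∧ icosahedron.Adj a b ∧ icosahedron.Adj a c := by
    decide +kernel
  obtain ⟨i, a, rfl⟩ := exists_copyVertex_eq hk x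
  obtain ⟨b, c, hbc, hb, hc⟩ := h a
  exact ⟨_, _, (copyVertex_injective i).ne hbc, fanCompletion_adj_copyVertex i hb,
    fanCompletion_adj_copyVertex i hc⟩

theorem fanCompletion_isTriangulation (hk : 1 ≤ k) : (fanCompletion k).IsTriangulation := by
  have hconn : (fanCompletion k).Connected := (gluedIcosahedra_connected hk).mono le_sup_left
  have hE : Nat.card (fanCompletion k).edgeSet + 6 = 3 * Nat.card (GluedVertex k) := by
    rw [natCard_edgeSet_fanCompletion hk, natCard_gluedVertex]
    omega
  have hdeg := exists_two_neighbors hk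
  refine ((isTriangularFaceMap_fanThird hk).isPlanar ?_ hconn ?_ hE).isTriangulation hconn hdeg hE
  · rintro ⟨⟨x, y⟩, h⟩ ⟨⟨x', y'⟩, h'⟩ (rfl : x = x')
    exact (sameRotation hk h h').choose_spec.choose_spec
  · exact fun v => ⟨_, (hdeg v).choose_spec.choose_spec.2.1⟩

theorem isCompletion_fanCompletion (hk : 1 ≤ k) : IsCompletion k (fanCompletion k) := by
  refine ⟨fanCompletion_isTriangulation hk, le_sup_left, fun x y h hn => ?_⟩
  obtain ⟨j, -, ⟨rfl, rfl⟩ | ⟨rfl, rfl⟩⟩ := rimFan_adj.1 (h.resolve_left hn)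
  · exact ⟨Or.inr ⟨_, rfl⟩, Or.inr ⟨_, rfl⟩⟩
  · exact ⟨Or.inr ⟨_, rfl⟩, Or.inr ⟨_, rfl⟩⟩

end

/-! ### Lower bounds for dominating sets -/

theorem SimpleGraph.exists_adj_of_induce_connected {V : Type*} {G : SimpleGraph V} {S : Finset V}
    (h : (G.induce (S : Set V)).Connected) {Q : Set V} {q s : V} (hq : q ∈ S) (hqQ : q ∈ Q)
    (hs : s ∈ S) (hsQ : s ∉ Q) : ∃ a ∈ Q, ∃ b ∈ S, b ∉ Q ∧ G.Adj a b := by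
  obtain ⟨p⟩ := h.preconnected ⟨q, hq⟩ ⟨s, hs⟩
  obtain ⟨d, -, hd1, hd2⟩ := p.exists_boundary_dart {x | x.1 ∈ Q} hqQ hsQ
  exact ⟨d.fst.1, hd1, d.snd.1, d.snd.2, hd2, d.adj⟩

section

variable {k : ℕ} {H : SimpleGraph (GluedVertex k)}

theorem IsCompletion.adj_innerCopy (hH : IsCompletion k H) {i : Fin k} {m : Fin 9}
    {y : GluedVertex k} :
    H.Adj (innerCopy i m) y ↔ ∃ b, icosahedron.Adj (innerVertex m) b ∧ copyVertex i b = y := by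
  rw [← gluedIcosahedra_adj_inner]
  refine ⟨fun h => ?_, fun h => hH.2.1 h⟩
  by_contra hn
  obtain ⟨h | ⟨j, h⟩, -⟩ := hH.2.2 _ _ h hn <;> simp at h

open scoped Classical in
/-- The indices of the vertices `p_j` in `S`. -/
noncomputable def rimTrace (S : Finset (GluedVertex k)) : Finset (Fin (k + 1)) :=
  Finset.univ.filter fun j => rim j ∈ S

open scoped Classical in
/-- The inner vertices of the `i`-th icosahedron in `S`. -/
noncomputable def innerTrace (S : Finset (GluedVertex k)) (i : Fin k) : Finset (Fin 9) :=
  Finset.univ.filter fun m => innerCopy i m ∈ S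

@[simp] theorem mem_rimTrace {S : Finset (GluedVertex k)} {j : Fin (k + 1)} :
    j ∈ rimTrace S ↔ rim j ∈ S := by simp [rimTrace]

@[simp] theorem mem_innerTrace {S : Finset (GluedVertex k)} {i : Fin k} {m : Fin 9} :
    m ∈ innerTrace S i ↔ innerCopy i m ∈ S := by simp [innerTrace]

open scoped Classical in
theorem card_eq_traces (S : Finset (GluedVertex k)) :
    S.card = (if hub k ∈ S then 1 else 0) + (rimTrace S).card + ∑ i, (innerTrace S i).card := by
  have h : S.card = ∑ x, if x ∈ S then 1 else 0 := by
    rw [Finset.sum_boole]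
    simp
  rw [h, Fintype.sum_sum_type, Fintype.sum_sum_type, Fintype.sum_prod_type, Finset.univ_unique,
    Finset.sum_singleton, ← add_assoc]
  simp only [rimTrace, innerTrace, Finset.card_filter]
  rfl

/-- The inner vertices of a copy are dominated from within that copy. -/
theorem IsCompletion.dominated_innerVertex (hH : IsCompletion k H) {S : Finset (GluedVertex k)}
    (hS : H.IsDominatingSet S) (i : Fin k) (m : Fin 9) :
    ∃ a, copyVertex i a ∈ S ∧ (a = innerVertex m ∨ icosahedron.Adj (innerVertex m) a) := by
  rcases hS (innerCopy i m) with h | ⟨w, hw, h⟩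
  · exact ⟨innerVertex m, by simpa using h, Or.inl rfl⟩
  · obtain ⟨b, hb, rfl⟩ := hH.adj_innerCopy.1 h
    exact ⟨b, hw, Or.inr hb⟩

theorem IsCompletion.innerTrace_nonempty (hH : IsCompletion k H) {S : Finset (GluedVertex k)}
    (hS : H.IsDominatingSet S) (i : Fin k) : (innerTrace S i).Nonempty := by
  -- A vertex of the triangle opposite to the outer one has no neighbour on the outer triangle.
  have h9 : ∀ a, a = innerVertex 6 ∨ icosahedron.Adj (innerVertex 6) a →
      ∃ m, a = innerVertex m := by
    decide
  obtain ⟨a, ha, h⟩ := hH.dominated_innerVertex hS i 6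
  obtain ⟨m, rfl⟩ := h9 a h
  exact ⟨m, by simpa using ha⟩

theorem IsCompletion.two_le_card_innerTrace_of_outer (hH : IsCompletion k H)
    {S : Finset (GluedVertex k)} (hS : H.IsDominatingSet S)
    (ho : ∀ x ∈ outerVertices k, x ∉ S) (i : Fin k) : 2 ≤ (innerTrace S i).card := by
  have h1 : ∀ m, ∃ n, innerVertex m ≠ innerVertex n ∧
      ¬ icosahedron.Adj (innerVertex n) (innerVertex m) := by
    decide +kernel
  by_contra! hlt
  have hpos := (hH.innerTrace_nonempty hS i).card_pos
  obtain ⟨m, hm⟩ := Finset.card_eq_one.1 (by omega : (innerTrace S i).card = 1)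
  obtain ⟨n, hn, hn'⟩ := h1 m
  obtain ⟨a, ha, h⟩ := hH.dominated_innerVertex hS i n
  rcases eq_outer_or_innerVertex a with rfl | rfl | rfl | ⟨l, rfl⟩
  · exact ho _ (Or.inl rfl) ha
  · exact ho _ (Or.inr ⟨_, rfl⟩) ha
  · exact ho _ (Or.inr ⟨_, rfl⟩) ha
  · have hl : l ∈ innerTrace S i := by simpa using ha
    rw [hm, Finset.mem_singleton] at hl
    subst hl
    exact h.elim hn hn'

theorem IsCompletion.succ_le_card (hk : 1 ≤ k) (hH : IsCompletion k H)
    {S : Finset (GluedVertex k)} (hS : H.IsDominatingSet S) : k + 1 ≤ S.card := by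
  classical
  by_cases ho : ∀ x ∈ outerVertices k, x ∉ S
  · have h := Finset.card_nsmul_le_sum Finset.univ (fun i => (innerTrace S i).card) 2
      fun i _ => hH.two_le_card_innerTrace_of_outer hS ho i
    have := card_eq_traces S
    simp at h
    omega
  · have h := Finset.card_nsmul_le_sum Finset.univ (fun i => (innerTrace S i).card) 1
      fun i _ => (hH.innerTrace_nonempty hS i).card_pos
    have hc := card_eq_traces S
    simp at h
    push Not at ho
    obtain ⟨x, rfl | ⟨j, rfl⟩, hx⟩ := ho
    · rw [if_pos hx] at hc
      omega
    · have : 0 < (rimTrace S).card := Finset.card_pos.2 ⟨j, by simpa using hx⟩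
      omega

/-- If a connected set does not only consist of inner vertices of the `i`-th icosahedron from `M`,
then some vertex of `M` has a neighbour in the rest of the set, and this neighbour lies in the
same copy. -/
theorem IsCompletion.exists_adj_innerTrace (hH : IsCompletion k H) {S : Finset (GluedVertex k)}
    (hS : (H.induce (S : Set (GluedVertex k))).Connected) {i : Fin k} (M : Finset (Fin 9))
    {m : Fin 9} (hm : m ∈ M) (hmS : innerCopy i m ∈ S) {s : GluedVertex k} (hs : s ∈ S)
    (hsM : ∀ m ∈ M, s ≠ innerCopy i m) :
    ∃ m ∈ M, ∃ a, copyVertex i a ∈ S ∧ (∀ n ∈ M, a ≠ innerVertex n) ∧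
      icosahedron.Adj (innerVertex m) a := by
  obtain ⟨x, ⟨n, hn, rfl⟩, y, hyS, hy, hadj⟩ :=
    SimpleGraph.exists_adj_of_induce_connected hS (Q := innerCopy i '' (M : Set (Fin 9))) hmS
      ⟨m, hm, rfl⟩ hs fun ⟨n, hn, h⟩ => hsM n hn h.symm
  obtain ⟨a, ha, rfl⟩ := hH.adj_innerCopy.1 hadj
  exact ⟨n, hn, a, hyS, fun l hl h => hy ⟨l, hl, by simp [h]⟩, ha⟩

/-- A connected dominating set with vertices on the outer cycle has at least two inner vertices in
each icosahedron. -/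
theorem IsCompletion.two_le_card_innerTrace (hH : IsCompletion k H)
    {S : Finset (GluedVertex k)} (hS : H.IsConnectedDominatingSet S)
    {o : GluedVertex k} (ho : o ∈ outerVertices k) (hoS : o ∈ S) (i : Fin k) :
    2 ≤ (innerTrace S i).card := by
  have hfin : ∀ m o, (o = 0 ∨ o = 1 ∨ o = 2) → icosahedron.Adj (innerVertex m) o →
      ∃ n, innerVertex m ≠ innerVertex n ∧ ¬ icosahedron.Adj (innerVertex n) (innerVertex m) ∧
        ∀ o, (o = 0 ∨ o = 1 ∨ o = 2) → ¬ icosahedron.Adj (innerVertex n) o := by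
    decide +kernel
  have hne : ∀ i m, o ≠ innerCopy i m := by
    rcases ho with rfl | ⟨j, rfl⟩ <;> simp
  by_contra! hlt
  have hpos := (hH.innerTrace_nonempty hS.1 i).card_pos
  obtain ⟨m, hm⟩ := Finset.card_eq_one.1 (by omega : (innerTrace S i).card = 1)
  have hmS : innerCopy i m ∈ S := by
    rw [← mem_innerTrace, hm, Finset.mem_singleton]
  have key : ∀ a, copyVertex i a ∈ S → a = innerVertex m ∨ a = 0 ∨ a = 1 ∨ a = 2 := by
    intro a ha
    rcases eq_outer_or_innerVertex a with h | h | h | ⟨l, rfl⟩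
    · exact Or.inr (Or.inl h)
    · exact Or.inr (Or.inr (Or.inl h))
    · exact Or.inr (Or.inr (Or.inr h))
    · have hl : l ∈ innerTrace S i := by simpa using ha
      rw [hm, Finset.mem_singleton] at hl
      exact Or.inl (by rw [hl])
  obtain ⟨_, hm', a, haS, ha, hadj⟩ := hH.exists_adj_innerTrace hS.2 {m}
    (Finset.mem_singleton_self m) hmS hoS fun n _ => hne i n
  rw [Finset.mem_singleton] at hm'
  subst hm'
  obtain ⟨n, hn1, hn2, hn3⟩ := hfin _ a
    ((key a haS).resolve_left (ha _ (Finset.mem_singleton_self _))) hadj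
  obtain ⟨b, hbS, hb⟩ := hH.dominated_innerVertex hS.1 i n
  rcases key b hbS with rfl | h
  · exact hb.elim hn1 hn2
  · rcases hb with rfl | hb
    · exact innerVertex_not_outer n h
    · exact hn3 b h hb

/-- One outer vertex `o` and two inner vertices that are joined to it do not dominate the inner
vertices of the icosahedron. -/
theorem exists_not_dominated (o : Fin 12) (ho : o = 0 ∨ o = 1 ∨ o = 2) : ∀ a b : Fin 9,
    (icosahedron.Adj (innerVertex a) o ∨ icosahedron.Adj (innerVertex b) o) →
    (icosahedron.Adj (innerVertex a) o ∨ icosahedron.Adj (innerVertex a) (innerVertex b)) →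
    (icosahedron.Adj (innerVertex b) o ∨ icosahedron.Adj (innerVertex b) (innerVertex a)) →
    ∃ n, n ≠ a ∧ n ≠ b ∧ ¬ icosahedron.Adj (innerVertex n) o ∧
      ¬ icosahedron.Adj (innerVertex n) (innerVertex a) ∧
      ¬ icosahedron.Adj (innerVertex n) (innerVertex b) := by
  rcases ho with rfl | rfl | rfl <;> decide +kernel

/-- If a connected dominating set with vertices on the outer cycle has only two inner vertices in
the `i`-th icosahedron, then it has two of the outer vertices of this icosahedron. -/
theorem IsCompletion.two_outer_of_card_innerTrace_eq_two (hH : IsCompletion k H)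
    {S : Finset (GluedVertex k)} (hS : H.IsConnectedDominatingSet S)
    {s : GluedVertex k} (hs : s ∈ outerVertices k) (hsS : s ∈ S) {i : Fin k}
    (hi : (innerTrace S i).card = 2) (o : Fin 12) (ho : o = 0 ∨ o = 1 ∨ o = 2) :
    ∃ p, (p = 0 ∨ p = 1 ∨ p = 2) ∧ p ≠ o ∧ copyVertex i p ∈ S := by
  by_contra! hno
  have hne : ∀ i m, s ≠ innerCopy i m := by
    rcases hs with rfl | ⟨j, rfl⟩ <;> simp
  obtain ⟨a, b, hab, hP⟩ := Finset.card_eq_two.1 hi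
  have haS : innerCopy i a ∈ S := by rw [← mem_innerTrace, hP]; simp
  have hbS : innerCopy i b ∈ S := by rw [← mem_innerTrace, hP]; simp
  have key : ∀ c, copyVertex i c ∈ S → c = o ∨ c = innerVertex a ∨ c = innerVertex b := by
    intro c hc
    by_cases hco : c = o
    · exact Or.inl hco
    rcases eq_outer_or_innerVertex c with h | h | h | ⟨l, rfl⟩
    · exact absurd hc (hno c (Or.inl h) hco)
    · exact absurd hc (hno c (Or.inr (Or.inl h)) hco)
    · exact absurd hc (hno c (Or.inr (Or.inr h)) hco)
    · have hl : l ∈ innerTrace S i := by simpa using hc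
      rw [hP, Finset.mem_insert, Finset.mem_singleton] at hl
      exact Or.inr (hl.imp (congrArg _) (congrArg _))
  have h1 : icosahedron.Adj (innerVertex a) o ∨ icosahedron.Adj (innerVertex b) o := by
    obtain ⟨m, hm, c, hcS, hc, hadj⟩ := hH.exists_adj_innerTrace hS.2 {a, b}
      (by simp) haS hsS fun n _ => hne i n
    obtain rfl : c = o := (key c hcS).resolve_right fun h =>
      h.elim (hc a (by simp)) (hc b (by simp))
    rw [Finset.mem_insert, Finset.mem_singleton] at hm
    rcases hm with rfl | rfl
    · exact Or.inl hadj
    · exact Or.inr hadj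
  have h2 : icosahedron.Adj (innerVertex a) o ∨
      icosahedron.Adj (innerVertex a) (innerVertex b) := by
    obtain ⟨m, hm, c, hcS, hc, hadj⟩ := hH.exists_adj_innerTrace hS.2 {a}
      (by simp) haS hsS fun n _ => hne i n
    obtain rfl := Finset.mem_singleton.1 hm
    rcases key c hcS with rfl | rfl | rfl
    · exact Or.inl hadj
    · exact absurd rfl (hc _ hm)
    · exact Or.inr hadj
  have h3 : icosahedron.Adj (innerVertex b) o ∨
      icosahedron.Adj (innerVertex b) (innerVertex a) := by
    obtain ⟨m, hm, c, hcS, hc, hadj⟩ := hH.exists_adj_innerTrace hS.2 {b}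
      (by simp) hbS hsS fun n _ => hne i n
    obtain rfl := Finset.mem_singleton.1 hm
    rcases key c hcS with rfl | rfl | rfl
    · exact Or.inl hadj
    · exact Or.inr hadj
    · exact absurd rfl (hc _ hm)
  obtain ⟨n, hna, hnb, hno', hna', hnb'⟩ := exists_not_dominated o ho a b h1 h2 h3
  obtain ⟨c, hcS, hc⟩ := hH.dominated_innerVertex hS.1 i n
  rcases key c hcS with rfl | rfl | rfl
  · rcases hc with rfl | hc
    · exact innerVertex_not_outer n ho
    · exact hno' hc
  · exact hc.elim (fun h => hna (innerVertex_injective h).symm) hna'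
  · exact hc.elim (fun h => hnb (innerVertex_injective h).symm) hnb'

/-- No three vertices inducing a connected subgraph dominate the icosahedron; stated for vertices
off its outer triangle. -/
theorem exists_not_dominated_three : ∀ a b c : Fin 9,
    (icosahedron.Adj (innerVertex a) (innerVertex b) ∨
      icosahedron.Adj (innerVertex a) (innerVertex c)) →
    (icosahedron.Adj (innerVertex b) (innerVertex a) ∨
      icosahedron.Adj (innerVertex b) (innerVertex c)) →
    (icosahedron.Adj (innerVertex c) (innerVertex a) ∨
      icosahedron.Adj (innerVertex c) (innerVertex b)) →
    ∃ x, (x ≠ innerVertex a ∧ ¬ icosahedron.Adj (innerVertex a) x) ∧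
      (x ≠ innerVertex b ∧ ¬ icosahedron.Adj (innerVertex b) x) ∧
      (x ≠ innerVertex c ∧ ¬ icosahedron.Adj (innerVertex c) x) := by
  decide +kernel

/-- A connected dominating set without vertices on the outer cycle only exists if there is just one
icosahedron, and it has at least four vertices. -/
theorem IsCompletion.four_le_card_of_outer (hk : 1 ≤ k) (hH : IsCompletion k H)
    {S : Finset (GluedVertex k)} (hS : H.IsConnectedDominatingSet S)
    (ho : ∀ x ∈ outerVertices k, x ∉ S) : k = 1 ∧ 4 ≤ S.card := by
  classical
  have hcopy : ∀ i a, copyVertex i a ∈ S → ∃ m ∈ innerTrace S i, a = innerVertex m := by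
    intro i a ha
    rcases eq_outer_or_innerVertex a with rfl | rfl | rfl | ⟨l, rfl⟩
    · exact absurd ha (ho _ (Or.inl rfl))
    · exact absurd ha (ho _ (Or.inr ⟨_, rfl⟩))
    · exact absurd ha (ho _ (Or.inr ⟨_, rfl⟩))
    · exact ⟨l, by simpa using ha, rfl⟩
  obtain ⟨m₀, hm₀⟩ := hH.innerTrace_nonempty hS.1 ⟨0, hk⟩
  have hall : ∀ s ∈ S, ∃ m, s = innerCopy ⟨0, hk⟩ m := by
    intro s hs
    by_contra! hne
    obtain ⟨m, hm, a, haS, ha, -⟩ := hH.exists_adj_innerTrace hS.2 (innerTrace S ⟨0, hk⟩) hm₀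
      (mem_innerTrace.1 hm₀) hs fun m _ => hne m
    obtain ⟨n, hn, rfl⟩ := hcopy _ _ haS
    exact ha n hn rfl
  have hk1 : k = 1 := by
    by_contra hk1
    obtain ⟨m, hm⟩ := hH.innerTrace_nonempty hS.1 ⟨1, by omega⟩
    obtain ⟨n, hn⟩ := hall _ (mem_innerTrace.1 hm)
    simp at hn
  refine ⟨hk1, ?_⟩
  by_contra! hlt
  have hle : (innerTrace S ⟨0, hk⟩).card ≤ S.card := by
    refine Finset.card_le_card_of_injOn (innerCopy ⟨0, hk⟩) (fun m hm => mem_innerTrace.1 hm) ?_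
    intro m _ n _ h
    exact (innerCopy_inj.1 h).2
  have h2 := hH.two_le_card_innerTrace_of_outer hS.1 ho ⟨0, hk⟩
  -- The trace is listed by three vertices, of which two may coincide.
  obtain ⟨a, b, c, hP⟩ : ∃ a b c, innerTrace S ⟨0, hk⟩ = {a, b, c} := by
    rcases (by omega : (innerTrace S ⟨0, hk⟩).card = 2 ∨ (innerTrace S ⟨0, hk⟩).card = 3) with h | h
    · obtain ⟨a, b, -, h⟩ := Finset.card_eq_two.1 h
      exact ⟨a, b, b, by simp [h]⟩
    · obtain ⟨a, b, c, -, -, -, h⟩ := Finset.card_eq_three.1 h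
      exact ⟨a, b, c, h⟩
  have hmem : ∀ m, innerCopy ⟨0, hk⟩ m ∈ S ↔ m = a ∨ m = b ∨ m = c := by
    intro m
    rw [← mem_innerTrace, hP]
    simp
  have hadj : ∀ m, (m = a ∨ m = b ∨ m = c) → ∃ n, (n = a ∨ n = b ∨ n = c) ∧
      icosahedron.Adj (innerVertex m) (innerVertex n) := by
    intro m hm
    obtain ⟨n, hn, hnm⟩ := Finset.exists_mem_ne (by omega : 1 < (innerTrace S ⟨0, hk⟩).card) m
    obtain ⟨m', hm', x, hxS, -, hx⟩ := hH.exists_adj_innerTrace hS.2 {m}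
      (Finset.mem_singleton_self m) ((hmem m).2 hm) (mem_innerTrace.1 hn) (by simpa using hnm)
    obtain rfl := Finset.mem_singleton.1 hm'
    obtain ⟨l, hl, rfl⟩ := hcopy _ _ hxS
    exact ⟨l, (hmem l).1 (mem_innerTrace.1 hl), hx⟩
  obtain ⟨x, hxa, hxb, hxc⟩ := exists_not_dominated_three a b c
    (by obtain ⟨n, rfl | rfl | rfl, h⟩ := hadj a (by simp) <;> simp_all)
    (by obtain ⟨n, rfl | rfl | rfl, h⟩ := hadj b (by simp) <;> simp_all)
    (by obtain ⟨n, rfl | rfl | rfl, h⟩ := hadj c (by simp) <;> simp_all)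
  have hx : ∀ m, (m = a ∨ m = b ∨ m = c) →
      x ≠ innerVertex m ∧ ¬ icosahedron.Adj (innerVertex m) x := by
    rintro m (rfl | rfl | rfl) <;> assumption
  rcases hS.1 (copyVertex ⟨0, hk⟩ x) with h | ⟨w, hw, h⟩
  · obtain ⟨m, hm, rfl⟩ := hcopy _ _ h
    exact (hx m ((hmem m).1 (mem_innerTrace.1 hm))).1 rfl
  · obtain ⟨m, rfl⟩ := hall w hw
    obtain ⟨y, hy, hyx⟩ := hH.adj_innerCopy.1 h.symm
    rw [copyVertex_injective _ hyx] at hy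
    exact (hx m ((hmem m).1 hw)).2 hy

theorem IsCompletion.le_card_of_connected (hk : 1 ≤ k) (hH : IsCompletion k H)
    {S : Finset (GluedVertex k)} (hS : H.IsConnectedDominatingSet S) :
    2 * k + (k + 1) / 2 + 1 ≤ S.card := by
  classical
  by_cases ho : ∀ x ∈ outerVertices k, x ∉ S
  · obtain ⟨rfl, h⟩ := hH.four_le_card_of_outer hk hS ho
    exact h
  push Not at ho
  obtain ⟨o, ho, hoS⟩ := ho
  -- `M` collects the icosahedra with only two inner vertices in `S`; all others have three.
  set M : Finset (Fin k) := Finset.univ.filter fun i => (innerTrace S i).card = 2 with hM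
  have hsum : 3 * k ≤ ∑ i, (innerTrace S i).card + M.card := by
    rw [hM, Finset.card_filter, ← Finset.sum_add_distrib]
    have h := Finset.card_nsmul_le_sum Finset.univ
      (fun i => (innerTrace S i).card + if (innerTrace S i).card = 2 then 1 else 0) 3 fun i _ => by
        have := hH.two_le_card_innerTrace hS ho hoS i
        split_ifs <;> omega
    simpa [mul_comm] using h
  have hMk : M.card ≤ k := by simpa using M.card_le_univ
  have hc := card_eq_traces S
  have hleft : (Finset.univ.filter fun i : Fin k => i.castSucc ∈ rimTrace S).card ≤
      (rimTrace S).card :=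
    Finset.card_le_card_of_injOn Fin.castSucc (fun i hi => by simpa using hi)
      (Fin.castSucc_injective k).injOn
  have hright : (Finset.univ.filter fun i : Fin k => i.succ ∈ rimTrace S).card ≤
      (rimTrace S).card :=
    Finset.card_le_card_of_injOn Fin.succ (fun i hi => by simpa using hi)
      (Fin.succ_injective k).injOn
  have hMi : ∀ i ∈ M, (innerTrace S i).card = 2 := fun i hi => (Finset.mem_filter.1 hi).2
  by_cases hhub : hub k ∈ S
  · rw [if_pos hhub] at hc
    -- Each of these icosahedra has a vertex `p_j` in `S`, and each `p_j` lies in at most two.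
    have hsub : M ⊆ (Finset.univ.filter fun i : Fin k => i.castSucc ∈ rimTrace S) ∪
        Finset.univ.filter fun i : Fin k => i.succ ∈ rimTrace S := by
      intro i hi
      obtain ⟨p, rfl | rfl | rfl, hp, hpS⟩ :=
        hH.two_outer_of_card_innerTrace_eq_two hS ho hoS (hMi i hi) 0 (Or.inl rfl)
      · exact absurd rfl hp
      · simp_all
      · simp_all
    have := (Finset.card_le_card hsub).trans (Finset.card_union_le _ _)
    omega
  · rw [if_neg hhub] at hc
    have hR : 0 < (rimTrace S).card := by
      rcases ho with rfl | ⟨j, rfl⟩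
      · exact absurd hoS hhub
      · exact Finset.card_pos.2 ⟨j, mem_rimTrace.2 hoS⟩
    have hboth : ∀ i ∈ M, i.castSucc ∈ rimTrace S ∧ i.succ ∈ rimTrace S := by
      intro i hi
      constructor
      · obtain ⟨p, rfl | rfl | rfl, hp, hpS⟩ := hH.two_outer_of_card_innerTrace_eq_two hS ho hoS
          (hMi i hi) 2 (Or.inr (Or.inr rfl))
        · exact absurd hpS hhub
        · simpa using hpS
        · exact absurd rfl hp
      · obtain ⟨p, rfl | rfl | rfl, hp, hpS⟩ := hH.two_outer_of_card_innerTrace_eq_two hS ho hoS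
          (hMi i hi) 1 (Or.inr (Or.inl rfl))
        · exact absurd hpS hhub
        · exact absurd rfl hp
        · simpa using hpS
    have hMR : M.card ≤ (rimTrace S).card :=
      Finset.card_le_card_of_injOn Fin.succ (fun i hi => (hboth i hi).2)
        (Fin.succ_injective k).injOn
    rcases M.eq_empty_or_nonempty with hM0 | ⟨i, hi⟩
    · rw [hM0, Finset.card_empty] at hsum
      omega
    · have h2 : 1 < (rimTrace S).card := Finset.one_lt_card.2
        ⟨_, (hboth i hi).1, _, (hboth i hi).2, by simp [Fin.ext_iff]⟩
      omega

end

/-! ### Small dominating sets -/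

section

variable {k : ℕ} {H : SimpleGraph (GluedVertex k)}

theorem IsCompletion.adj_copyVertex (hH : IsCompletion k H) (i : Fin k) {a b : Fin 12}
    (h : icosahedron.Adj a b) : H.Adj (copyVertex i a) (copyVertex i b) :=
  hH.2.1 (gluedIcosahedra_adj_copyVertex i h)

theorem IsCompletion.isDominatingSet_of_copies (hk : 1 ≤ k) (hH : IsCompletion k H)
    {S : Finset (GluedVertex k)}
    (h : ∀ i a, ∃ b, copyVertex i b ∈ S ∧ (a = b ∨ icosahedron.Adj a b)) :
    H.IsDominatingSet S := by
  intro x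
  obtain ⟨i, a, rfl⟩ := exists_copyVertex_eq hk x
  obtain ⟨b, hb, rfl | hab⟩ := h i a
  · exact Or.inl hb
  · exact Or.inr ⟨_, hb, hH.adj_copyVertex i hab⟩

/-- The vertex `u` together with its antipode in each of the icosahedra is a dominating set. -/
theorem IsCompletion.exists_isDominatingSet (hk : 1 ≤ k) (hH : IsCompletion k H) :
    ∃ S : Finset (GluedVertex k), H.IsDominatingSet S ∧ S.card ≤ k + 1 := by
  classical
  refine ⟨insert (hub k) (Finset.univ.image fun i => copyVertex i 10),
    hH.isDominatingSet_of_copies hk fun i a => ?_, ?_⟩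
  · have h : ∀ a : Fin 12, (a = 0 ∨ icosahedron.Adj a 0) ∨ (a = 10 ∨ icosahedron.Adj a 10) := by
      decide
    rcases h a with h | h
    · exact ⟨0, by simp, h⟩
    · exact ⟨10, by simp, h⟩
  · refine (Finset.card_insert_le _ _).trans (Nat.succ_le_succ ?_)
    exact Finset.card_image_le.trans (by simp)

/-- A connected dominating set: the vertex `u`, the vertices `p_j` with `j` odd, so that every
icosahedron has one of them, and two more vertices of each icosahedron. -/
theorem IsCompletion.exists_isConnectedDominatingSet (hk : 1 ≤ k) (hH : IsCompletion k H) :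
    ∃ S : Finset (GluedVertex k), H.IsConnectedDominatingSet S ∧
      S.card ≤ 2 * k + (k + 1) / 2 + 1 := by
  classical
  set R : Finset (GluedVertex k) := Finset.univ.image fun l : Fin ((k + 1) / 2) =>
    rim ⟨2 * l + 1, by omega⟩ with hR
  set A : Finset (GluedVertex k) := Finset.univ.image fun i => copyVertex i 8 with hA
  set B : Finset (GluedVertex k) := Finset.univ.image fun i : Fin k =>
    copyVertex i (if i.val % 2 = 0 then 9 else 11) with hB
  have hrim : ∀ j : Fin (k + 1), j.val % 2 = 1 → rim j ∈ R := by
    intro j hj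
    refine Finset.mem_image.2 ⟨⟨j / 2, by omega⟩, Finset.mem_univ _, ?_⟩
    refine congrArg rim (Fin.ext ?_)
    change 2 * (j.val / 2) + 1 = j.val
    omega
  have hmem : ∀ x, x ∈ insert (hub k) (R ∪ A ∪ B) ↔ x = hub k ∨ x ∈ R ∨ x ∈ A ∨ x ∈ B := by
    intro x
    simp
  have hAmem : ∀ i, copyVertex i 8 ∈ A := fun i => Finset.mem_image_of_mem _ (Finset.mem_univ i)
  have hBmem : ∀ i : Fin k, copyVertex i (if i.val % 2 = 0 then 9 else 11) ∈ B := fun i =>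
    Finset.mem_image.2 ⟨i, Finset.mem_univ i, rfl⟩
  refine ⟨insert (hub k) (R ∪ A ∪ B), ⟨hH.isDominatingSet_of_copies hk fun i a => ?_, ?_⟩, ?_⟩
  · by_cases hi : i.val % 2 = 0
    · have h : ∀ a : Fin 12, ∃ b, (b = 0 ∨ b = 2 ∨ b = 8 ∨ b = 9) ∧
          (a = b ∨ icosahedron.Adj a b) := by
        decide +kernel
      obtain ⟨b, hb, hab⟩ := h a
      refine ⟨b, (hmem _).2 ?_, hab⟩
      rcases hb with rfl | rfl | rfl | rfl
      · exact Or.inl rfl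
      · exact Or.inr (Or.inl (hrim _ (by rw [Fin.val_succ]; omega)))
      · exact Or.inr (Or.inr (Or.inl (hAmem i)))
      · have := hBmem i
        rw [if_pos hi] at this
        exact Or.inr (Or.inr (Or.inr this))
    · have h : ∀ a : Fin 12, ∃ b, (b = 0 ∨ b = 1 ∨ b = 8 ∨ b = 11) ∧
          (a = b ∨ icosahedron.Adj a b) := by
        decide +kernel
      obtain ⟨b, hb, hab⟩ := h a
      refine ⟨b, (hmem _).2 ?_, hab⟩
      rcases hb with rfl | rfl | rfl | rfl
      · exact Or.inl rfl
      · exact Or.inr (Or.inl (hrim _ (by rw [Fin.val_castSucc]; omega)))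
      · exact Or.inr (Or.inr (Or.inl (hAmem i)))
      · have := hBmem i
        rw [if_neg hi] at this
        exact Or.inr (Or.inr (Or.inr this))
  · have hu : hub k ∈ (insert (hub k) (R ∪ A ∪ B) : Finset (GluedVertex k)) := by simp
    rw [SimpleGraph.connected_iff_exists_forall_reachable]
    refine ⟨⟨hub k, hu⟩, ?_⟩
    have hA' : ∀ i (h : copyVertex i 8 ∈ insert (hub k) (R ∪ A ∪ B)),
        (H.induce (↑(insert (hub k) (R ∪ A ∪ B)) : Set (GluedVertex k))).Reachable
          ⟨hub k, hu⟩ ⟨copyVertex i 8, h⟩ := fun i h =>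
      SimpleGraph.Adj.reachable (hH.adj_copyVertex i (a := 0) (b := 8) (by decide))
    rintro ⟨x, hx⟩
    rcases (hmem x).1 hx with rfl | h | h | h
    · rfl
    · obtain ⟨l, -, rfl⟩ := Finset.mem_image.1 h
      exact SimpleGraph.Adj.reachable (hH.2.1 (gluedIcosahedra_adj_hub_rim hk _))
    · obtain ⟨i, -, rfl⟩ := Finset.mem_image.1 h
      exact hA' i hx
    · obtain ⟨i, -, rfl⟩ := Finset.mem_image.1 h
      have h8 : icosahedron.Adj 8 (if i.val % 2 = 0 then 9 else 11) := by
        split_ifs <;> decide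
      exact (hA' i ((hmem _).2 (Or.inr (Or.inr (Or.inl (hAmem i)))))).trans
        (SimpleGraph.Adj.reachable (hH.adj_copyVertex i (a := 8) h8))
  · have h1 : R.card ≤ (k + 1) / 2 := Finset.card_image_le.trans (by simp)
    have h2 : A.card ≤ k := Finset.card_image_le.trans (by simp)
    have h3 : B.card ≤ k := Finset.card_image_le.trans (by simp)
    have h4 := Finset.card_insert_le (hub k) (R ∪ A ∪ B)
    have h5 := Finset.card_union_le (R ∪ A) B
    have h6 := Finset.card_union_le R A
    omega

/-! ### The domination numbers -/

theorem IsCompletion.dominationNumber_eq (hk : 1 ≤ k) (hH : IsCompletion k H) :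
    H.dominationNumber = k + 1 := by
  obtain ⟨S, hS, hcard⟩ := hH.exists_isDominatingSet hk
  refine IsLeast.csInf_eq ⟨⟨S, hS, hcard.antisymm (hH.succ_le_card hk hS)⟩, ?_⟩
  rintro n ⟨T, hT, rfl⟩
  exact hH.succ_le_card hk hT

theorem IsCompletion.connectedDominationNumber_eq (hk : 1 ≤ k) (hH : IsCompletion k H) :
    H.connectedDominationNumber = 2 * k + (k + 1) / 2 + 1 := by
  obtain ⟨S, hS, hcard⟩ := hH.exists_isConnectedDominatingSet hk
  refine IsLeast.csInf_eq ⟨⟨S, hS, hcard.antisymm (hH.le_card_of_connected hk hS)⟩, ?_⟩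
  rintro n ⟨T, hT, rfl⟩
  exact hH.le_card_of_connected hk hT

end

theorem proposition5p3 :
    -- there is a family of triangulations `H k`, built from `k` icosahedra, for which the
    -- difference of the two domination numbers grows arbitrarily large
    (∃ H : (k : ℕ) → SimpleGraph (GluedVertex k),
      (∀ k, 1 ≤ k → (H k).IsTriangulation ∧ IsCompletion k (H k)) ∧
      Tendsto (fun k => ((H k).connectedDominationNumber : ℤ) - ((H k).dominationNumber : ℤ))
        atTop atTop) ∧
    -- the values for every completion; `(k + 1) / 2` is `k / 2` rounded up
    (∀ k, 1 ≤ k → ∀ H : SimpleGraph (GluedVertex k), IsCompletion k H →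
      H.dominationNumber = k + 1 ∧
      H.connectedDominationNumber = 2 * k + (k + 1) / 2 + 1) := by
  refine ⟨⟨fanCompletion, fun k hk =>
    ⟨fanCompletion_isTriangulation hk, isCompletion_fanCompletion hk⟩, ?_⟩,
    fun k hk H hH => ⟨hH.dominationNumber_eq hk, hH.connectedDominationNumber_eq hk⟩⟩
  refine tendsto_atTop_mono' _ ?_ tendsto_natCast_atTop_atTop
  filter_upwards [eventually_ge_atTop 1] with k hk
  rw [(isCompletion_fanCompletion hk).dominationNumber_eq hk,
    (isCompletion_fanCompletion hk).connectedDominationNumber_eq hk]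
  omega
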